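/- Let $\mathrm{Leb}$ be the Lebesgue measure on $[0,1]$. A permuton is a probability measure on $[0,1]^2$ both of whose projections are equal to $\mathrm{Leb}$. The set $\mathcal P$ of permutons carries the topology of weak convergence and its Borel $\sigma$-algebra; a random permuton is a random element of $\mathcal P$. For permutons $\mu,\nu$, $u\in[0,1]$ and a sign $S\in\{\oplus,\ominus\}$, let $\mu\otimes_{(u,S)}\nu$ be the permuton that is the sum of a copy of $\mu$ of total weight $u$, rescaled affinely (by increasing affine maps in each coordinate) to the square $[0,u]^2$ if $S=\oplus$ and to $[0,u]\times[1-u,1]$ if $S=\ominus$, and of a copy of $\nu$ of total weight $1-u$, rescaled in the same way to $[u,1]^2$ if $S=\oplus$ and to $[u,1]\times[0,1-u]$ if $S=\ominus$. For $p\in[0,1]$ and a probability measure $\mathbb Q$ on $\mathcal P$, let $\Phi_p(\mathbb Q)$ be the law of $\boldsymbol\mu_0\otimes_{(U,S)}\boldsymbol\mu_1$, where $\boldsymbol\mu_0,\boldsymbol\mu_1$ have law $\mathbb Q$, $U$ is uniform in $[0,1]$, $S$ is a random sign with $\mathbb P(S=\oplus)=p$, and $\boldsymbol\mu_0,\boldsymbol\mu_1,U,S$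 are independent. Let $p\in[0,1]$. Let $(U_j)_{j\ge1}$ and $(S_j)_{j\ge1}$ be independent sequences of i.i.d. random variables, where $U_j$ is uniform in $[0,1]$ and $S_j$ is a random sign with $\mathbb P(S_j=\oplus)=p$. For $x,y\in[0,1]$ write $x\prec y$ if some $U_j$ lies in $(\min(x,y),\max(x,y)]$ and, for the smallest such $j$, either $S_j=\oplus$ and $x<y$, or $S_j=\ominus$ and $y<x$. Put $\phi(x)=\mathrm{Leb}\{y\in[0,1]: y\prec x\}$, and let the recursive separable permuton $\mu^{\mathrm{rec}}_p$ be the push-forward of $\mathrm{Leb}$ by $x\mapsto(x,\phi(x))$. **Proposition 1.3.** Almost surely $\mu^{\mathrm{rec}}_p$ is a permuton, and (with an arbitrary fixed permuton as its value on the exceptional null event) it is a random permuton. Moreover: 1. The law of $\mu^{\mathrm{rec}}_p$ is a fixed point of $\Phi_p$: $\Phi_p(\mathrm{Law}(\mu^{\mathrm{rec}}_p))=\mathrm{Law}(\mu^{\mathrm{rec}}_p)$. 2. If a random permuton $\boldsymbol\nu$ satisfies $\Phi_p(\mathrm{Law}(\boldsymbol\nu))=\mathrm{Law}(\boldsymbol\nu)$,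 then $\boldsymbol\nu$ has the same law as $\mu^{\mathrm{rec}}_p$. 3. For all probability measures $\mathbb Q,\mathbb R$ on $\mathcal P$, $\mathbf d_W(\Phi_p(\mathbb Q),\Phi_p(\mathbb R))\le\tfrac23\,\mathbf d_W(\mathbb Q,\mathbb R)$, where $\mathbf d_W(\mathbb Q,\mathbb R)=\inf\mathbb E[d_W(\boldsymbol\mu,\boldsymbol\nu)]$ over all pairs of random permutons $\boldsymbol\mu\sim\mathbb Q$, $\boldsymbol\nu\sim\mathbb R$ defined on a common probability space, and $d_W(\mu,\nu)=\inf\mathbb E\|X-Y\|_2$ over all pairs of random points $X\sim\mu$, $Y\sim\nu$ of $[0,1]^2$ defined on a common probability space. -/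

import Mathlib

open MeasureTheory ProbabilityTheory
open scoped unitInterval ENNReal

noncomputable section

namespace RecSep

/-! Throughout, `I` is the unit interval `[0,1]`, its `volume` is the Lebesgue measure `Leb`, and
the signs are encoded by `Bool`: `true` is `⊕` and `false` is `⊖`. -/

/-- A measure on the unit square is a permuton if both its projections are the Lebesgue measure
(it is then automatically a probability measure). -/
def IsPermuton (μ : Measure (I × I)) : Prop :=
  μ.map Prod.fst = volume ∧ μ.map Prod.snd = volume

/-- The set of permutons. As a subtype of `ProbabilityMeasure (I × I)`, it carries the topology of
weak convergence and the σ-algebra generated by the evaluations `μ ↦ μ A`, `A` Borel, which is the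
Borel σ-algebra of that topology. -/
abbrev Permuton : Type := {μ : ProbabilityMeasure (I × I) // IsPermuton (μ : Measure (I × I))}

/-! ### The recursive separable permuton -/

/-- The relation `x ≺ y` on `[0,1]` defined by points `u j` and signs `s j`: one looks at the first
index `j` such that `u j` lies in `(min x y, max x y]`; if `s j = ⊕`, then `≺` is the usual order
for `x, y`, and if `s j = ⊖`, it is the reversed order. If there is no such index `j`, then `x ≺ y`
does not hold. -/
def Prec (u : ℕ → I) (s : ℕ → Bool) (x y : I) : Prop :=
  ∃ j, u j ∈ Set.Ioc (min x y) (max x y) ∧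
    (∀ i < j, u i ∉ Set.Ioc (min x y) (max x y)) ∧
    ((s j = true ∧ x < y) ∨ (s j = false ∧ y < x))

/-- The function `φ(x) = Leb {y : y ≺ x}`. -/
def phi (u : ℕ → I) (s : ℕ → Bool) (x : I) : I :=
  ⟨(volume : Measure I).real {y | Prec u s y x}, measureReal_nonneg, measureReal_le_one⟩

/-- The push-forward of the Lebesgue measure by `x ↦ (x, φ(x))`. -/
def phiMeasure (u : ℕ → I) (s : ℕ → Bool) : Measure (I × I) :=
  (volume : Measure I).map fun x => (x, phi u s x)

lemma IsPermuton.isProbabilityMeasure {μ : Measure (I × I)} (h : IsPermuton μ) :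
    IsProbabilityMeasure μ := by
  constructor
  have h1 := congrArg (fun m : Measure I => m Set.univ) h.1
  simpa [Measure.map_apply measurable_fst MeasurableSet.univ] using h1

/-- The permuton carried by the diagonal; only used as a default value. -/
def diagonalPermuton : Permuton :=
  ⟨⟨(volume : Measure I).map fun x => (x, x),
      Measure.isProbabilityMeasure_map (by fun_prop)⟩, by
    constructor
    · change ((volume : Measure I).map fun x => (x, x)).map Prod.fst = volume
      rw [Measure.map_map (by fun_prop) (by fun_prop)]
      exact Measure.map_id
    · change ((volume : Measure I).map fun x => (x, x)).map Prod.snd = volume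
      rw [Measure.map_map (by fun_prop) (by fun_prop)]
      exact Measure.map_id⟩

open Classical in
/-- The recursive separable permuton, as a function of the points `u j` and the signs `s j`: the
push-forward of `Leb` by `x ↦ (x, φ(x))` whenever that measure is a permuton. -/
def recPermuton (u : ℕ → I) (s : ℕ → Bool) : Permuton :=
  if h : IsPermuton (phiMeasure u s) then ⟨⟨phiMeasure u s, h.isProbabilityMeasure⟩, h⟩
  else diagonalPermuton

/-- The law of a random sign `S` with `P(S = ⊕) = p` and `P(S = ⊖) = 1 - p`. -/
def signLaw (p : I) : Measure Bool :=
  ENNReal.ofReal p • Measure.dirac true + ENNReal.ofReal (1 - p) • Measure.dirac false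

lemma ofReal_add_ofReal_one_sub (u : I) :
    ENNReal.ofReal (u : ℝ) + ENNReal.ofReal (1 - (u : ℝ)) = 1 := by
  rw [← ENNReal.ofReal_add u.2.1 (by linarith [u.2.2])]
  simp

instance (p : I) : IsProbabilityMeasure (signLaw p) := by
  constructor
  simpa [signLaw] using ofReal_add_ofReal_one_sub p

/-- `(U j)` and `(S j)` are two independent i.i.d. sequences on the probability space `(Ω, P)`, the
`U j` being uniform in `[0,1]` and the `S j` being random signs equal to `⊕` with probability `p`.
-/
structure IsDrivingSequence {Ω : Type*} [MeasurableSpace Ω] (P : Measure Ω) (p : I)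
    (U : ℕ → Ω → I) (S : ℕ → Ω → Bool) : Prop where
  hasLaw_U : ∀ j, HasLaw (U j) (volume : Measure I) P
  hasLaw_S : ∀ j, HasLaw (S j) (signLaw p) P
  iIndepFun_U : iIndepFun U P
  iIndepFun_S : iIndepFun S P
  indepFun : IndepFun (fun ω j => U j ω) (fun ω j => S j ω) P

/-! ### The operation `μ ⊗_(u,S) ν` -/

/-- The increasing affine map `x ↦ u x` from `[0,1]` onto `[0,u]`. -/
def lowMap (u x : I) : I := u * x

/-- The increasing affine map `x ↦ u + (1 - u) x` from `[0,1]` onto `[u,1]`. -/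
def highMap (u x : I) : I :=
  ⟨(u : ℝ) + (1 - (u : ℝ)) * (x : ℝ),
    add_nonneg u.2.1 (mul_nonneg (by linarith [u.2.2]) x.2.1), by
      nlinarith [u.2.2, x.2.2, u.2.1, x.2.1]⟩

/-- The affine map from the unit square onto the square that carries the copy of `μ` in
`μ ⊗_(u,S) ν`: this is `[0,u]²` if `S = ⊕` and `[0,u] × [1-u,1]` if `S = ⊖`. -/
def leftMap (u : I) (s : Bool) (z : I × I) : I × I :=
  (lowMap u z.1, if s then lowMap u z.2 else highMap (unitInterval.symm u) z.2)

/-- The affine map from the unit square onto the square that carries the copy of `ν` in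
`μ ⊗_(u,S) ν`: this is `[u,1]²` if `S = ⊕` and `[u,1] × [0,1-u]` if `S = ⊖`. -/
def rightMap (u : I) (s : Bool) (z : I × I) : I × I :=
  (highMap u z.1, if s then highMap u z.2 else lowMap (unitInterval.symm u) z.2)

/-- The measure `μ ⊗_(u,S) ν`: the sum of a rescaled copy of `μ` of weight `u` and a rescaled copy
of `ν` of weight `1 - u`. -/
def glueMeasure (u : I) (s : Bool) (μ ν : Measure (I × I)) : Measure (I × I) :=
  ENNReal.ofReal u • μ.map (leftMap u s) + ENNReal.ofReal (1 - u) • ν.map (rightMap u s)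

lemma measurable_lowMap : Measurable fun q : I × I => lowMap q.1 q.2 :=
  Measurable.subtype_mk (by fun_prop)

lemma measurable_highMap : Measurable fun q : I × I => highMap q.1 q.2 :=
  Measurable.subtype_mk (by fun_prop)

lemma measurable_symm : Measurable (unitInterval.symm) :=
  unitInterval.continuous_symm.measurable

lemma measurable_leftMap :
    Measurable fun q : (I × Bool) × (I × I) => leftMap q.1.1 q.1.2 q.2 := by
  refine Measurable.prodMk (measurable_lowMap.comp (by fun_prop :
    Measurable fun q : (I × Bool) × (I × I) => (q.1.1, q.2.1))) ?_
  refine Measurable.ite (measurableSet_eq_fun (by fun_prop) measurable_const)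
    (measurable_lowMap.comp (by fun_prop :
      Measurable fun q : (I × Bool) × (I × I) => (q.1.1, q.2.2)))
    (measurable_highMap.comp (?_ :
      Measurable fun q : (I × Bool) × (I × I) => (unitInterval.symm q.1.1, q.2.2)))
  exact (measurable_symm.comp (by fun_prop)).prodMk (by fun_prop)

lemma measurable_rightMap :
    Measurable fun q : (I × Bool) × (I × I) => rightMap q.1.1 q.1.2 q.2 := by
  refine Measurable.prodMk (measurable_highMap.comp (by fun_prop :
    Measurable fun q : (I × Bool) × (I × I) => (q.1.1, q.2.1))) ?_
  refine Measurable.ite (measurableSet_eq_fun (by fun_prop) measurable_const)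
    (measurable_highMap.comp (by fun_prop :
      Measurable fun q : (I × Bool) × (I × I) => (q.1.1, q.2.2)))
    (measurable_lowMap.comp (?_ :
      Measurable fun q : (I × Bool) × (I × I) => (unitInterval.symm q.1.1, q.2.2)))
  exact (measurable_symm.comp (by fun_prop)).prodMk (by fun_prop)

lemma volume_split (u : I) :
    ENNReal.ofReal u • (volume : Measure I).map (lowMap u)
      + ENNReal.ofReal (1 - u) • (volume : Measure I).map (highMap u) = volume := by
  have hl : Measurable (lowMap u) := measurable_lowMap.comp (by fun_prop :
    Measurable fun x : I => (u, x))
  have hh : Measurable (highMap u) := measurable_highMap.comp (by fun_prop :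
    Measurable fun x : I => (u, x))
  have hu0 := u.2.1
  have hu1 := u.2.2
  have key1 : ∀ a : I, ENNReal.ofReal u * volume (lowMap u ⁻¹' Set.Iic a)
      = ENNReal.ofReal (min (u : ℝ) a) := by
    intro a
    have ha0 := a.2.1
    rcases le_or_gt (u : ℝ) a with h | h
    · have : lowMap u ⁻¹' Set.Iic a = Set.univ := by
        ext x
        simp only [Set.mem_preimage, Set.mem_Iic, Set.mem_univ, iff_true, ← Subtype.coe_le_coe,
          lowMap, Set.Icc.coe_mul]
        nlinarith [x.2.2, x.2.1]
      rw [this, measure_univ, mul_one, min_eq_left h]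
    · have hpos : (0 : ℝ) < u := lt_of_le_of_lt ha0 h
      have : lowMap u ⁻¹' Set.Iic a
          = Set.Iic (⟨(a : ℝ) / u, by positivity, (div_le_one hpos).2 h.le⟩ : I) := by
        ext x
        simp only [Set.mem_preimage, Set.mem_Iic, ← Subtype.coe_le_coe, lowMap, Set.Icc.coe_mul]
        rw [le_div_iff₀ hpos, mul_comm]
      rw [this, unitInterval.volume_Iic, ← ENNReal.ofReal_mul hu0, min_eq_right h.le]
      congr 1
      field_simp
  have key2 : ∀ a : I, ENNReal.ofReal (1 - u) * volume (highMap u ⁻¹' Set.Iic a)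
      = ENNReal.ofReal ((a : ℝ) - min (u : ℝ) a) := by
    intro a
    have ha1 := a.2.2
    rcases eq_or_lt_of_le hu1 with h1 | h1
    · rw [h1, min_eq_right ha1]; simp
    · have hpos : (0 : ℝ) < 1 - u := by linarith
      rcases le_or_gt (u : ℝ) a with h | h
      · have : highMap u ⁻¹' Set.Iic a
            = Set.Iic (⟨((a : ℝ) - u) / (1 - u), div_nonneg (by linarith) hpos.le,
              (div_le_one hpos).2 (by linarith)⟩ : I) := by
          ext x
          simp only [Set.mem_preimage, Set.mem_Iic, ← Subtype.coe_le_coe, highMap]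
          rw [le_div_iff₀ hpos]
          constructor <;> intro _ <;> linarith
        rw [this, unitInterval.volume_Iic, ← ENNReal.ofReal_mul hpos.le, min_eq_left h]
        congr 1
        field_simp
      · have : highMap u ⁻¹' Set.Iic a = ∅ := by
          ext x
          simp only [Set.mem_preimage, Set.mem_Iic, ← Subtype.coe_le_coe, highMap,
            Set.mem_empty_iff_false, iff_false, not_le]
          nlinarith [x.2.1]
        rw [this, min_eq_right h.le]; simp
  symm
  refine Measure.ext_of_Iic _ _ fun a => ?_
  rw [Measure.add_apply, Measure.smul_apply, Measure.smul_apply, smul_eq_mul, smul_eq_mul,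
    Measure.map_apply hl measurableSet_Iic, Measure.map_apply hh measurableSet_Iic, key1, key2,
    ← ENNReal.ofReal_add (le_min hu0 a.2.1) (by linarith [min_le_right (u : ℝ) a]),
    unitInterval.volume_Iic]
  congr 1
  ring

lemma glueMeasure_isPermuton (u : I) (s : Bool) {μ ν : Measure (I × I)} (hμ : IsPermuton μ)
    (hν : IsPermuton ν) : IsPermuton (glueMeasure u s μ ν) := by
  have hL : Measurable (leftMap u s) := measurable_leftMap.comp (by fun_prop :
    Measurable fun z : I × I => ((u, s), z))
  have hR : Measurable (rightMap u s) := measurable_rightMap.comp (by fun_prop :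
    Measurable fun z : I × I => ((u, s), z))
  have hl : ∀ v, Measurable (lowMap v) := fun v => measurable_lowMap.comp (by fun_prop :
    Measurable fun x : I => (v, x))
  have hh : ∀ v, Measurable (highMap v) := fun v => measurable_highMap.comp (by fun_prop :
    Measurable fun x : I => (v, x))
  have aux : ∀ {m : Measure (I × I)} {T : I × I → I × I} {pr : I × I → I} {g : I → I},
      Measurable T → Measurable pr → Measurable g → m.map pr = volume →
      (∀ z, pr (T z) = g (pr z)) → (m.map T).map pr = (volume : Measure I).map g := by
    intro m T pr g hT hpr hg hm h
    rw [Measure.map_map hpr hT, ← hm, Measure.map_map hg hpr]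
    congr 1
    funext z
    exact h z
  constructor
  · rw [glueMeasure, Measure.map_add _ _ measurable_fst, Measure.map_smul, Measure.map_smul,
      aux hL measurable_fst (hl u) hμ.1 (fun _ => rfl),
      aux hR measurable_fst (hh u) hν.1 (fun _ => rfl)]
    exact volume_split u
  · rw [glueMeasure, Measure.map_add _ _ measurable_snd, Measure.map_smul, Measure.map_smul]
    cases s
    · rw [aux hL measurable_snd (hh (unitInterval.symm u)) hμ.2 (fun _ => by simp [leftMap]),
        aux hR measurable_snd (hl (unitInterval.symm u)) hν.2 (fun _ => by simp [rightMap]),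
        add_comm]
      simpa using volume_split (unitInterval.symm u)
    · rw [aux hL measurable_snd (hl u) hμ.2 (fun _ => by simp [leftMap]),
        aux hR measurable_snd (hh u) hν.2 (fun _ => by simp [rightMap])]
      exact volume_split u

/-- The permuton `μ ⊗_(u,S) ν`. -/
def glue (u : I) (s : Bool) (μ ν : Permuton) : Permuton :=
  ⟨⟨glueMeasure u s μ.1 ν.1, (glueMeasure_isPermuton u s μ.2 ν.2).isProbabilityMeasure⟩,
    glueMeasure_isPermuton u s μ.2 ν.2⟩

/-! ### The map `Φ_p` on laws of random permutons -/

lemma measurable_map_apply {T : (I × Bool) → I × I → I × I}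
    (hT : Measurable fun q : (I × Bool) × (I × I) => T q.1 q.2) {A : Set (I × I)}
    (hA : MeasurableSet A) :
    Measurable fun q : Permuton × (I × Bool) => ((q.1.1 : Measure (I × I)).map (T q.2)) A := by
  let κ : Kernel (Permuton × (I × Bool)) (I × I) :=
    ⟨fun q => (q.1.1 : Measure (I × I)),
      measurable_subtype_coe.comp (measurable_subtype_coe.comp measurable_fst)⟩
  have : IsMarkovKernel κ := ⟨fun q => q.1.1.2⟩
  have hm := Kernel.measurable_kernel_prodMk_left (κ := κ)
    (t := {w : (Permuton × (I × Bool)) × (I × I) | T w.1.2 w.2 ∈ A})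
    ((hT.comp (by fun_prop :
      Measurable fun w : (Permuton × (I × Bool)) × (I × I) => (w.1.2, w.2))) hA)
  have he : (fun q : Permuton × (I × Bool) => ((q.1.1 : Measure (I × I)).map (T q.2)) A)
      = fun q => κ q (Prod.mk q ⁻¹' {w | T w.1.2 w.2 ∈ A}) := by
    funext q
    have hq : Measurable (T q.2) :=
      hT.comp (by fun_prop : Measurable fun z : I × I => (q.2, z))
    rw [Measure.map_apply hq hA]
    rfl
  rw [he]
  exact hm

lemma measurable_glue :
    Measurable fun z : (Permuton × Permuton) × (I × Bool) =>
      glue z.2.1 z.2.2 z.1.1 z.1.2 := by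
  refine Measurable.subtype_mk (Measurable.subtype_mk ?_)
  refine Measure.measurable_of_measurable_coe _ fun A hA => ?_
  have h1 := (measurable_map_apply (T := fun q => leftMap q.1 q.2) measurable_leftMap hA).comp (by fun_prop :
    Measurable fun z : (Permuton × Permuton) × (I × Bool) => (z.1.1, z.2))
  have h2 := (measurable_map_apply (T := fun q => rightMap q.1 q.2) measurable_rightMap hA).comp (by fun_prop :
    Measurable fun z : (Permuton × Permuton) × (I × Bool) => (z.1.2, z.2))
  have h3 : Measurable fun z : (Permuton × Permuton) × (I × Bool) =>
      ENNReal.ofReal (z.2.1 : ℝ) := by fun_prop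
  have h4 : Measurable fun z : (Permuton × Permuton) × (I × Bool) =>
      ENNReal.ofReal (1 - (z.2.1 : ℝ)) := by fun_prop
  exact (h3.mul h1).add (h4.mul h2)

/-- The map `Φ_p` on laws of random permutons: `Φ_p Q` is the law of `μ₀ ⊗_(U,S) μ₁`, where
`μ₀` and `μ₁` have law `Q`, `U` is uniform in `[0,1]`, `S` is a random sign with `P(S = ⊕) = p`,
and `μ₀`, `μ₁`, `U`, `S` are independent. -/
def Phi (p : I) (Q : ProbabilityMeasure Permuton) : ProbabilityMeasure Permuton :=
  ⟨(((Q : Measure Permuton).prod (Q : Measure Permuton)).prod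
      ((volume : Measure I).prod (signLaw p))).map
        fun z : (Permuton × Permuton) × (I × Bool) => glue z.2.1 z.2.2 z.1.1 z.1.2,
    Measure.isProbabilityMeasure_map measurable_glue.aemeasurable⟩

/-! ### Wasserstein distances -/

/-- The first Wasserstein distance between two probability measures on a space `X` whose distance
is `d`: the infimum of `E[d(Y, Y')]` over all couplings `(Y, Y')` of the two measures. -/
def wasserstein {X : Type*} [MeasurableSpace X] (d : X → X → ℝ≥0∞) (μ ν : ProbabilityMeasure X) :
    ℝ≥0∞ :=
  ⨅ γ : {γ : Measure (X × X) // γ.map Prod.fst = μ ∧ γ.map Prod.snd = ν},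
    ∫⁻ z, d z.1 z.2 ∂γ.1

/-- The Euclidean distance on the unit square. -/
def squareDist (a b : I × I) : ℝ≥0∞ :=
  ENNReal.ofReal (√(((a.1 : ℝ) - b.1) ^ 2 + ((a.2 : ℝ) - b.2) ^ 2))

/-- The first Wasserstein distance on the set of permutons. -/
def permutonDist (μ ν : Permuton) : ℝ≥0∞ := wasserstein squareDist μ.1 ν.1

/-- The first Wasserstein distance on laws of random permutons, the set of permutons being endowed
with the first Wasserstein distance. -/
def lawDist (P Q : ProbabilityMeasure Permuton) : ℝ≥0∞ := wasserstein permutonDist P Q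

end RecSep

end

/-! If the points `u j` separate any two points of `[0,1]`, which holds almost surely, then `≺` is a
strict linear order: record for each `x` the bits "`u j ≤ x`", flipped when the sign is `⊖`, and `≺`
becomes the lexicographic order of these bit sequences (`prec_iff_itinerary_lt`). So `φ` is the rank
function of a linear order on an atomless probability space, hence uniformly distributed
(`map_rank_eq_volume`). This is the only nontrivial marginal of the permuton.

Fixed point. The first point `v` cuts `[0,1]` in two, and the later points and signs that fall on
either side, rescaled, are again driving sequences. The proof runs this decomposition backwards:
from two independent driving sequences, a marked point `(v, t)` and independent uniforms `r j` whose
coins `r j ≤ v` decide on which side the next point falls, `glueSeq` builds one sequence. It is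
again a driving sequence (`measurePreserving_glueSeq`), so no conditioning is needed, and its
permuton is the `⊗_(v,t)` of the two given ones (`phiMeasure_glue`).

Contraction. Couple two pairs of permutons independently and glue both with the same `(v, t)`. The
two parts have weights `v`, `1 - v` and are shrunk by the factors `v`, `1 - v`, so transport costs
are multiplied by `v²` and `(1 - v)²`. Each has mean `1/3`, which gives `2/3` (`lawDist_Phi_le`).

Uniqueness. All distances are at most `2`, so the contraction puts two fixed points at distance `0`.
That this forces equality (`eq_of_lawDist_eq_zero`) is shown without optimal couplings: the
characteristic functions of the integrals `∫ f dμ`, for `f` Lipschitz, vary continuously with the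
distance and determine the law. -/

namespace RecSep

/-! ### Uniform distribution of the rank in a linear order -/

section Uniform

variable {X α : Type*} [MeasurableSpace X] [LinearOrder α] {m : Measure X} [IsFiniteMeasure m]
  {a : X → α}

lemma measurable_measure_lt (ha : MeasurableSet {q : X × X | a q.1 < a q.2}) :
    Measurable fun x => m {y | a y < a x} :=
  measurable_measure_prodMk_right ha

/-- Moments of the rank function of a linear order, on an initial segment `D`. -/
lemma lintegral_rank_pow [NullSingletonClass m] (hinj : Function.Injective a)
    (ha : MeasurableSet {q : X × X | a q.1 < a q.2}) (n : ℕ) :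
    ∀ D : Set X, MeasurableSet D → (∀ x ∈ D, ∀ y, a y < a x → y ∈ D) →
      (n + 1 : ℝ≥0∞) * ∫⁻ x in D, (m {y | a y < a x}) ^ n ∂m = m D ^ (n + 1) := by
  have hfib : ∀ x, MeasurableSet {y | a y < a x} := fun x => measurable_prodMk_right ha
  have hfib' : ∀ x, MeasurableSet {y | a x < a y} := fun x => measurable_prodMk_left ha
  have hmeas := measurable_measure_lt (m := m) ha
  induction n with
  | zero => intro D hD _; simp
  | succ n ih =>
    intro D hD hdown
    set f : X → ℝ≥0∞ := fun x => m {y | a y < a x} with hf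
    set A := ∫⁻ x in D, f x ^ (n + 1) ∂m with hA
    -- For `x` in the initial segment `D`, the mass of `D` splits into the rank of `x` and the mass
    -- of the points of `D` above `x`; the point `x` itself is null.
    have h1 : A + ∫⁻ x in D, f x ^ n * m ({y | a x < a y} ∩ D) ∂m
        = (∫⁻ x in D, f x ^ n ∂m) * m D := by
      rw [hA, ← lintegral_add_left (hmeas.pow_const _), ← lintegral_mul_const _ (hmeas.pow_const _)]
      refine setLIntegral_congr_fun hD fun x hx => ?_
      rw [pow_succ, ← mul_add]
      congr 1
      have h2 : D = insert x ({y | a y < a x} ∪ ({y | a x < a y} ∩ D)) := by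
        ext y
        simp only [Set.mem_insert_iff, Set.mem_union, Set.mem_ofPred_eq, Set.mem_inter_iff]
        constructor
        · intro hy
          rcases lt_trichotomy (a y) (a x) with h | h | h
          · exact Or.inr (Or.inl h)
          · exact Or.inl (hinj h)
          · exact Or.inr (Or.inr ⟨h, hy⟩)
        · rintro (rfl | h | h)
          · exact hx
          · exact hdown x hx y h
          · exact h.2
      conv_rhs => rw [h2, measure_congr (insert_ae_eq_self _ _)]
      rw [measure_union _ ((hfib' x).inter hD)]
      exact Set.disjoint_left.2 fun y hy hy' => lt_asymm hy hy'.1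
    -- After exchanging the integrals, the inner one runs over the initial segment below `y`, to
    -- which the induction hypothesis applies. This is why the statement is proved for all `D`.
    have h2 : (n + 1 : ℝ≥0∞) * ∫⁻ x in D, f x ^ n * m ({y | a x < a y} ∩ D) ∂m = A := by
      have e1 : ∀ x, f x ^ n * m ({y | a x < a y} ∩ D)
          = ∫⁻ y in D, ({q : X × X | a q.1 < a q.2}.indicator (fun q => f q.1 ^ n)) (x, y) ∂m := by
        intro x
        rw [← Measure.restrict_apply (hfib' x), ← lintegral_indicator_const (hfib' x)]
        rfl
      have hF : Measurable ({q : X × X | a q.1 < a q.2}.indicator (fun q => f q.1 ^ n)) :=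
        ((hmeas.comp measurable_fst).pow_const n).indicator ha
      simp_rw [e1]
      rw [lintegral_lintegral_swap (f := fun x y =>
        ({q : X × X | a q.1 < a q.2}.indicator (fun q => f q.1 ^ n)) (x, y)) hF.aemeasurable,
        ← lintegral_const_mul _ (by exact hF.lintegral_prod_left')]
      refine setLIntegral_congr_fun hD fun y hy => ?_
      rw [← ih {x | a x < a y} (hfib y) (fun x hx z hz => lt_trans hz hx)]
      congr 1
      have e2 : ∀ x, ({q : X × X | a q.1 < a q.2}.indicator (fun q => f q.1 ^ n)) (x, y)
          = ({x | a x < a y}.indicator fun x => f x ^ n) x := fun x => rfl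
      simp_rw [e2]
      rw [lintegral_indicator (hfib y), Measure.restrict_restrict (hfib y)]
      congr 2
      ext x
      exact ⟨fun h => h.1, fun h => ⟨h, hdown y hy x h⟩⟩
    have h3 := ih D hD hdown
    push_cast
    calc ((n : ℝ≥0∞) + 1 + 1) * A
        = (n + 1) * A + A := by ring
      _ = (n + 1) * A + (n + 1 : ℝ≥0∞) * ∫⁻ x in D, f x ^ n * m ({y | a x < a y} ∩ D) ∂m := by
          rw [h2]
      _ = ((n + 1) * ∫⁻ x in D, f x ^ n ∂m) * m D := by rw [← mul_add, h1, mul_assoc]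
      _ = m D ^ (n + 1 + 1) := by rw [h3, ← pow_succ]

end Uniform

/-- A probability measure on the unit interval is determined by its moments. -/
lemma ext_of_moments {μ ν : Measure I} [IsFiniteMeasure μ] [IsFiniteMeasure ν]
    (h : ∀ n : ℕ, ∫ x, (x : ℝ) ^ n ∂μ = ∫ x, (x : ℝ) ^ n ∂ν) : μ = ν := by
  have hint : ∀ (ρ : Measure I) [IsFiniteMeasure ρ] (f : C(I, ℝ)), Integrable f ρ := by
    intro ρ _ f
    exact f.continuous.integrable_of_hasCompactSupport (HasCompactSupport.of_compactSpace f)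
  have hpoly : ∀ p : Polynomial ℝ, ∫ x : I, p.eval (x : ℝ) ∂μ = ∫ x : I, p.eval (x : ℝ) ∂ν := by
    intro p
    induction p using Polynomial.induction_on' with
    | add p q hp hq =>
      have hi : ∀ (ρ : Measure I) [IsFiniteMeasure ρ] (p : Polynomial ℝ),
          Integrable (fun x : I => p.eval (x : ℝ)) ρ := fun ρ _ p =>
        hint ρ ⟨fun x : I => p.eval (x : ℝ), by fun_prop⟩
      simp only [Polynomial.eval_add]
      rw [integral_add (hi μ p) (hi μ q), integral_add (hi ν p) (hi ν q), hp, hq]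
    | monomial n c =>
      simp only [Polynomial.eval_monomial]
      rw [integral_const_mul, integral_const_mul, h n]
  have hclosed : ∀ (ρ : Measure I) [IsFiniteMeasure ρ],
      Continuous fun f : C(I, ℝ) => ∫ x, f x ∂ρ := by
    intro ρ _
    have : LipschitzWith (ρ.real Set.univ).toNNReal fun f : C(I, ℝ) => ∫ x, f x ∂ρ := by
      refine LipschitzWith.of_dist_le_mul fun f g => ?_
      rw [Real.dist_eq, ← integral_sub (hint ρ f) (hint ρ g), Real.coe_toNNReal _ measureReal_nonneg]
      have := norm_integral_le_of_norm_le_const (μ := ρ) (f := fun x => f x - g x) (C := dist f g)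
        (ae_of_all _ fun x => by
          rw [← dist_eq_norm]; exact ContinuousMap.dist_apply_le_dist x)
      rw [mul_comm]; simpa using this
    exact this.continuous
  refine ext_of_forall_integral_eq_of_IsFiniteMeasure fun f => ?_
  have hd : Dense ((polynomialFunctions I : Set C(I, ℝ))) := by
    have := polynomialFunctions_closure_eq_top'
    rw [dense_iff_closure_eq, ← Subalgebra.topologicalClosure_coe, this]; rfl
  have := (hclosed μ).ext_on hd (hclosed ν) (by
    rintro _ ⟨p, -, rfl⟩
    exact hpoly p)
  exact congrFun this f.toContinuousMap

/-- The moments of the rank function of a linear order. -/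
lemma integral_rank_pow {X α : Type*} [MeasurableSpace X] [LinearOrder α] {m : Measure X}
    [IsProbabilityMeasure m] [NullSingletonClass m] {a : X → α} (hinj : Function.Injective a)
    (ha : MeasurableSet {q : X × X | a q.1 < a q.2}) {g : X → I}
    (hg : ∀ x, (g x : ℝ) = m.real {y | a y < a x}) (n : ℕ) :
    ∫ x, (g x : ℝ) ^ n ∂m = ((n : ℝ) + 1)⁻¹ := by
  have h := lintegral_rank_pow (m := m) hinj ha n Set.univ MeasurableSet.univ (by simp)
  simp only [Measure.restrict_univ, measure_univ, one_pow] at h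
  rw [integral_eq_lintegral_of_nonneg_ae (ae_of_all _ fun x => pow_nonneg (g x).2.1 n)]
  · have e : ∀ x, ENNReal.ofReal ((g x : ℝ) ^ n) = (m {y | a y < a x}) ^ n := by
      intro x
      rw [hg, ENNReal.ofReal_pow measureReal_nonneg, ofReal_measureReal]
    simp_rw [e]
    rw [ENNReal.eq_inv_of_mul_eq_one_left (a := ∫⁻ x, m {y | a y < a x} ^ n ∂m)
      (b := (n + 1 : ℝ≥0∞)) (by rw [mul_comm]; exact h), ENNReal.toReal_inv]
    norm_cast
  · simp_rw [hg]
    exact ((measurable_measure_lt (m := m) ha).ennreal_toReal.pow_const n).aestronglyMeasurable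

/-- The rank function of a linear order pushes the measure to the uniform distribution. -/
lemma map_rank_eq_volume {X α : Type*} [MeasurableSpace X] [LinearOrder α] {m : Measure X}
    [IsProbabilityMeasure m] [NullSingletonClass m] {a : X → α} (hinj : Function.Injective a)
    (ha : MeasurableSet {q : X × X | a q.1 < a q.2}) {g : X → I}
    (hg : ∀ x, (g x : ℝ) = m.real {y | a y < a x}) : m.map g = volume := by
  have hgm : Measurable g := by
    refine measurable_comap_iff.2 ?_
    have e : Subtype.val ∘ g = fun x => m.real {y | a y < a x} := funext hg
    rw [e]
    exact (measurable_measure_lt (m := m) ha).ennreal_toReal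
  have : IsProbabilityMeasure (m.map g) := Measure.isProbabilityMeasure_map hgm.aemeasurable
  refine ext_of_moments fun n => ?_
  rw [integral_map hgm.aemeasurable (by fun_prop), integral_rank_pow hinj ha hg]
  -- In the usual order of `[0,1]` each point is its own rank, so the Lebesgue measure has the same
  -- moments.
  symm
  refine integral_rank_pow (X := I) (a := fun x : I => x) (g := id) Function.injective_id
    (measurableSet_lt measurable_fst measurable_snd) ?_ n
  intro x
  change (x : ℝ) = volume.real (Set.Iio x)
  rw [Measure.real, unitInterval.volume_Iio, ENNReal.toReal_ofReal x.2.1]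


/-! ### The relation `≺` as a lexicographic order -/

lemma mem_Ioc_min_max_iff {α : Type*} [LinearOrder α] (v x y : α) :
    v ∈ Set.Ioc (min x y) (max x y) ↔ ¬(v ≤ x ↔ v ≤ y) := by
  rcases le_total x y with h | h <;> simp only [h, min_eq_left, min_eq_right, max_eq_left,
    max_eq_right, Set.mem_Ioc, ← not_le] <;> grind

/-- Propositional core of `prec_iff_itinerary_lt`: `p`, `q` stand for `u j ≤ x`, `u j ≤ y`, and `l`,
`r` for `x < y`, `y < x`. This is the case `x < y`; the primed version is the case `y < x`. -/
lemma separation_sign_iff (p q l r : Prop) [Decidable p] [Decidable q] (b : Bool) :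
    l → (p → q) → ¬r → (¬(p ↔ q) ∧ (b = true ∧ l ∨ b = false ∧ r) ↔
      xor (decide p) (!b) = false ∧ xor (decide q) (!b) = true) := by
  cases b <;> by_cases p <;> by_cases q <;> simp_all

lemma separation_sign_iff' (p q l r : Prop) [Decidable p] [Decidable q] (b : Bool) :
    r → (q → p) → ¬l → (¬(p ↔ q) ∧ (b = true ∧ l ∨ b = false ∧ r) ↔
      xor (decide p) (!b) = false ∧ xor (decide q) (!b) = true) := by
  cases b <;> by_cases p <;> by_cases q <;> simp_all

/-- The itinerary of a point: `≺` is the lexicographic order of the itineraries. -/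
noncomputable def itinerary (u : ℕ → I) (s : ℕ → Bool) (x : I) : Lex (ℕ → Bool) :=
  toLex fun j => xor (decide (u j ≤ x)) (!s j)

/-- The index `j` separates `x` and `y` exactly when the bits "`u j ≤ x`" and "`u j ≤ y`" differ, so
the first separating index is the first disagreement of the itineraries. There the larger point has
the bit `true`, and a sign `⊖` flips both bits. -/
lemma prec_iff_itinerary_lt (u : ℕ → I) (s : ℕ → Bool) (x y : I) :
    Prec u s x y ↔ itinerary u s x < itinerary u s y := by
  change _ ↔ ∃ j, (∀ i < j, xor (decide (u i ≤ x)) (!s i) = xor (decide (u i ≤ y)) (!s i)) ∧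
    xor (decide (u j ≤ x)) (!s j) < xor (decide (u j ≤ y)) (!s j)
  refine exists_congr fun j => ?_
  simp only [mem_Ioc_min_max_iff, not_not, Bool.xor_left_inj, decide_eq_decide, Bool.lt_iff]
  rw [and_left_comm]
  refine and_congr_right fun _ => ?_
  rcases lt_trichotomy x y with h | h | h
  · have himp : u j ≤ x → u j ≤ y := fun h' => h'.trans h.le
    have := not_lt.2 h.le
    revert himp this h
    exact separation_sign_iff _ _ _ _ _
  · subst h
    simp
  · have himp : u j ≤ y → u j ≤ x := fun h' => h'.trans h.le
    have := not_lt.2 h.le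
    revert himp this h
    exact separation_sign_iff' _ _ _ _ _

/-- Any two points are separated by some `u j`. -/
def Separating (u : ℕ → I) : Prop := ∀ x y : I, x < y → ∃ j, u j ∈ Set.Ioc x y

lemma itinerary_injective {u : ℕ → I} (hu : Separating u) (s : ℕ → Bool) :
    Function.Injective (itinerary u s) := by
  intro x y h
  by_contra hne
  wlog hlt : x < y generalizing x y
  · exact this h.symm (Ne.symm hne) (lt_of_le_of_ne (not_lt.1 hlt) (Ne.symm hne))
  obtain ⟨j, hj⟩ := hu x y hlt
  have := congrFun (toLex.injective h) j
  simp [hj.2, not_le.2 hj.1] at this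

lemma measurableSet_prec :
    MeasurableSet {q : ((ℕ → I) × (ℕ → Bool)) × (I × I) | Prec q.1.1 q.1.2 q.2.1 q.2.2} := by
  have hB : ∀ j, MeasurableSet {q : ((ℕ → I) × (ℕ → Bool)) × (I × I) |
      q.1.1 j ∈ Set.Ioc (min q.2.1 q.2.2) (max q.2.1 q.2.2)} := fun j =>
    (measurableSet_lt (by fun_prop) (by fun_prop)).inter
      (measurableSet_le (by fun_prop) (by fun_prop))
  have hs : ∀ j (b : Bool), MeasurableSet {q : ((ℕ → I) × (ℕ → Bool)) × (I × I) | q.1.2 j = b} :=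
    fun j b => measurableSet_eq_fun (by fun_prop) measurable_const
  have : {q : ((ℕ → I) × (ℕ → Bool)) × (I × I) | Prec q.1.1 q.1.2 q.2.1 q.2.2}
      = ⋃ j, ({q | q.1.1 j ∈ Set.Ioc (min q.2.1 q.2.2) (max q.2.1 q.2.2)} ∩
        ((⋂ i, ⋂ (_ : i < j), {q | q.1.1 i ∈ Set.Ioc (min q.2.1 q.2.2) (max q.2.1 q.2.2)}ᶜ) ∩
        (({q | q.1.2 j = true} ∩ {q | q.2.1 < q.2.2}) ∪
          ({q | q.1.2 j = false} ∩ {q | q.2.2 < q.2.1})))) := by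
    ext q
    simp only [Prec, Set.mem_ofPred_eq, Set.mem_iUnion, Set.mem_inter_iff, Set.mem_iInter,
      Set.mem_compl_iff, Set.mem_union]
  rw [this]
  refine MeasurableSet.iUnion fun j => (hB j).inter
    ((MeasurableSet.iInter fun i => MeasurableSet.iInter fun _ => (hB i).compl).inter
    (((hs j true).inter (measurableSet_lt (by fun_prop) (by fun_prop))).union
      ((hs j false).inter (measurableSet_lt (by fun_prop) (by fun_prop)))))

lemma measurableSet_prec_left (u : ℕ → I) (s : ℕ → Bool) (x : I) :
    MeasurableSet {y | Prec u s y x} :=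
  measurableSet_prec.preimage (by fun_prop : Measurable fun y : I => ((u, s), (y, x)))

lemma measurable_phi :
    Measurable fun q : ((ℕ → I) × (ℕ → Bool)) × I => phi q.1.1 q.1.2 q.2 := by
  refine Measurable.subtype_mk ?_
  have h := measurable_measure_prodMk_left (ν := (volume : Measure I))
    (measurableSet_prec.preimage (by fun_prop :
      Measurable fun w : (((ℕ → I) × (ℕ → Bool)) × I) × I => (w.1.1, (w.2, w.1.2))))
  exact h.ennreal_toReal

lemma measurable_phi_right (u : ℕ → I) (s : ℕ → Bool) : Measurable (phi u s) :=
  measurable_phi.comp (by fun_prop : Measurable fun x : I => ((u, s), x))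

lemma measurable_phiMeasure :
    Measurable fun q : (ℕ → I) × (ℕ → Bool) => phiMeasure q.1 q.2 := by
  refine Measure.measurable_of_measurable_coe _ fun A hA => ?_
  have hm : Measurable fun q : ((ℕ → I) × (ℕ → Bool)) × I => (q.2, phi q.1.1 q.1.2 q.2) :=
    measurable_snd.prodMk measurable_phi
  have h := measurable_measure_prodMk_left (ν := (volume : Measure I)) (hm hA)
  convert h using 2 with q
  rw [phiMeasure, Measure.map_apply (measurable_id'.prodMk (measurable_phi_right _ _)) hA]
  rfl

/-- The first marginal is trivial; the second is the law of the rank in the lexicographic order,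
linear on points because itineraries are injective. -/
lemma isPermuton_phiMeasure {u : ℕ → I} (hu : Separating u) (s : ℕ → Bool) :
    IsPermuton (phiMeasure u s) := by
  have hm := measurable_phi_right u s
  constructor
  · rw [phiMeasure, Measure.map_map measurable_fst (measurable_id'.prodMk hm)]
    exact Measure.map_id
  · rw [phiMeasure, Measure.map_map measurable_snd (measurable_id'.prodMk hm)]
    refine map_rank_eq_volume (a := itinerary u s) (itinerary_injective hu s) ?_ fun x => ?_
    · convert measurableSet_prec.preimage
        (by fun_prop : Measurable fun q : I × I => ((u, s), q)) using 1
      ext q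
      exact (prec_iff_itinerary_lt u s q.1 q.2).symm
    · have e : {y | itinerary u s y < itinerary u s x} = {y | Prec u s y x} :=
        Set.ext fun y => (prec_iff_itinerary_lt u s y x).symm
      exact (congrArg (volume : Measure I).real e).symm

/-- An i.i.d. sequence almost surely visits infinitely often a set of positive measure. -/
lemma ae_frequently_mem {γ : Type*} [MeasurableSpace γ] (ρ : Measure γ) [IsProbabilityMeasure ρ]
    {A : Set γ} (hA : MeasurableSet A) (hpos : ρ A ≠ 0) :
    ∀ᵐ u ∂(Measure.infinitePi fun _ : ℕ => ρ), ∃ᶠ j in Filter.atTop, u j ∈ A := by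
  simp_rw [Filter.frequently_atTop]
  rw [ae_all_iff]
  intro n
  rw [ae_iff]
  have hc : ρ Aᶜ < 1 := by
    rw [prob_compl_eq_one_sub hA]
    exact ENNReal.sub_lt_self (by simp) (by simp) hpos
  -- Avoiding `A` from time `n` on implies avoiding it during the `k` steps `n, …, n + k - 1`.
  have hle : ∀ k : ℕ, (Measure.infinitePi fun _ : ℕ => ρ) {u | ¬∃ j ≥ n, u j ∈ A} ≤ (ρ Aᶜ) ^ k := by
    intro k
    have := Measure.infinitePi_pi (fun _ : ℕ => ρ) (s := Finset.Ico n (n + k))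
      (t := fun _ => Aᶜ) (fun _ _ => hA.compl)
    rw [Finset.prod_const, Nat.card_Ico, Nat.add_sub_cancel_left] at this
    rw [← this]
    exact measure_mono fun u hu j hj h => hu ⟨j, (Finset.mem_Ico.1 hj).1, h⟩
  exact le_antisymm (ge_of_tendsto' (ENNReal.tendsto_pow_atTop_nhds_zero_of_lt_one hc) hle) bot_le

/-- An i.i.d. sequence of uniform points almost surely separates any two points. -/
lemma ae_separating : ∀ᵐ u ∂(Measure.infinitePi fun _ : ℕ => (volume : Measure I)),
    Separating u := by
  have key : ∀ a b : I, a < b →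
      ∀ᵐ u ∂(Measure.infinitePi fun _ : ℕ => (volume : Measure I)), ∃ j, u j ∈ Set.Ioc a b := by
    intro a b hab
    filter_upwards [ae_frequently_mem volume (measurableSet_Ioc (a := a) (b := b))
      (by simpa using hab)] with u hu using hu.exists
  obtain ⟨D, hDc, hDd⟩ := TopologicalSpace.exists_countable_dense I
  have hD : ∀ᵐ u ∂(Measure.infinitePi fun _ : ℕ => (volume : Measure I)),
      ∀ a ∈ D, ∀ b ∈ D, a < b → ∃ j, u j ∈ Set.Ioc a b := by
    rw [ae_ball_iff hDc]
    intro a _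
    rw [ae_ball_iff hDc]
    intro b _
    by_cases h : a < b
    · filter_upwards [key a b h] with u hu _ using hu
    · exact ae_of_all _ fun u h' => absurd h' h
  filter_upwards [hD] with u hu x y hxy
  obtain ⟨a, ha, hxa, hay⟩ := hDd.exists_between hxy
  obtain ⟨b, hb, hab, hby⟩ := hDd.exists_between hay
  obtain ⟨j, hj⟩ := hu a ha b hb hab
  exact ⟨j, hxa.trans hj.1, hj.2.trans hby.le⟩


/-! ### Gluing points and signs glues the measures -/

/-- The sequence that takes its `j`-th term from the sequence `θ (b j)`, each of the two sequences
being consumed in order. -/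
def interleave {γ : Type*} (b : ℕ → Bool) (θ : Bool → ℕ → γ) (j : ℕ) : γ :=
  θ (b j) (Nat.count (fun i => b i = b j) j)

/-- The affine map onto `[0,v]` (if `c = true`) or `[v,1]` (if `c = false`). -/
noncomputable def side (v : I) (c : Bool) (x : I) : I := if c then lowMap v x else highMap v x

/-- The sequence of points that starts with `v` and then interleaves a sequence of points of
`[0,v]` and a sequence of points of `[v,1]`. -/
noncomputable def gluePoints (v : I) (b : ℕ → Bool) (u : Bool → ℕ → I) : ℕ → I
  | 0 => v
  | j + 1 => side v (b j) (interleave b u j)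

/-- The sequence of signs that goes with `gluePoints`. -/
def glueSigns (t : Bool) (b : ℕ → Bool) (s : Bool → ℕ → Bool) : ℕ → Bool
  | 0 => t
  | j + 1 => interleave b s j

/-- Indices that do not separate the two points are irrelevant, so passing to a subsequence that
keeps all separating indices does not change `≺`. -/
lemma prec_iff_of_reindex {u u' : ℕ → I} {s s' : ℕ → Bool} {x y x' y' : I} {n : ℕ → ℕ}
    (hn : StrictMono n)
    (hmem : ∀ k, u' (n k) ∈ Set.Ioc (min x' y') (max x' y') ↔ u k ∈ Set.Ioc (min x y) (max x y))
    (hrange : ∀ j, u' j ∈ Set.Ioc (min x' y') (max x' y') → ∃ k, n k = j)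
    (hs : ∀ k, s' (n k) = s k) (hlt : x' < y' ↔ x < y) (hgt : y' < x' ↔ y < x) :
    Prec u' s' x' y' ↔ Prec u s x y := by
  constructor
  · rintro ⟨j, hj, hfirst, h⟩
    obtain ⟨k, rfl⟩ := hrange j hj
    refine ⟨k, (hmem k).1 hj, fun i hi hi' => hfirst (n i) (hn hi) ((hmem i).2 hi'), ?_⟩
    rwa [hs, hlt, hgt] at h
  · rintro ⟨k, hk, hfirst, h⟩
    refine ⟨n k, (hmem k).2 hk, fun i hi hi' => ?_, by rwa [hs, hlt, hgt]⟩
    obtain ⟨l, rfl⟩ := hrange i hi'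
    exact hfirst l (hn.lt_iff_lt.1 hi) ((hmem l).1 hi')

lemma prec_iff_of_separated_by_head {u : ℕ → I} {s : ℕ → Bool} {x y : I}
    (h : u 0 ∈ Set.Ioc (min x y) (max x y)) :
    Prec u s x y ↔ (s 0 = true ∧ x < y) ∨ (s 0 = false ∧ y < x) := by
  constructor
  · rintro ⟨j, -, hfirst, hj⟩
    rcases Nat.eq_zero_or_pos j with rfl | hpos
    · exact hj
    · exact absurd h (hfirst 0 hpos)
  · exact fun h' => ⟨0, h, fun i hi => absurd hi (Nat.not_lt_zero i), h'⟩

section Side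

variable {v : I} (h0 : 0 < v) (h1 : v < 1)
include h0 h1

lemma side_le_side (c : Bool) (w x : I) : side v c w ≤ side v c x ↔ w ≤ x := by
  have h0' : (0 : ℝ) < v := h0
  have h1' : (v : ℝ) < 1 := h1
  cases c
  · simp only [side, highMap, ← Subtype.coe_le_coe, Bool.false_eq_true, if_false]
    rw [add_le_add_iff_left, mul_le_mul_iff_right₀ (by linarith)]
  · simp only [side, lowMap, ← Subtype.coe_le_coe, if_true, Set.Icc.coe_mul]
    rw [mul_le_mul_iff_right₀ h0']

lemma side_lt_side (c : Bool) (w x : I) : side v c w < side v c x ↔ w < x := by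
  rw [← not_le, side_le_side h0 h1, not_le]

omit h1 in
lemma low_lt {x : I} (hx : x < 1) : side v true x < v := by
  have h0' : (0 : ℝ) < v := h0
  have hx' : (x : ℝ) < 1 := hx
  simp only [side, lowMap, ← Subtype.coe_lt_coe, if_true, Set.Icc.coe_mul]
  nlinarith

omit h0 in
lemma le_high (x : I) : v ≤ side v false x := by
  have h1' : (v : ℝ) < 1 := h1
  simp only [side, highMap, ← Subtype.coe_le_coe, Bool.false_eq_true, if_false]
  nlinarith [x.2.1]

/-- The case `x = 1` must be excluded: its image in `[0,v]` is `v`, which the half-open intervals of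
`Prec` group with the upper side. -/
lemma le_side_iff (c : Bool) {x : I} (hx : x < 1) : v ≤ side v c x ↔ c = false := by
  cases c
  · simp [le_high h1]
  · simp [low_lt h0 hx]

/-- The answer does not depend on `w` or `x`: points placed on one side never separate two points of
the other side. -/
lemma side_le_side_of_ne {c d : Bool} (hcd : d ≠ c) {w x : I} (hx : x < 1) :
    side v d w ≤ side v c x ↔ c = false := by
  cases c <;> cases d <;> simp only [ne_eq, not_true_eq_false] at hcd
  · simp only [iff_true]
    refine le_trans ?_ (le_high h1 x)
    have h0' : (0 : ℝ) < v := h0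
    simp only [side, lowMap, ← Subtype.coe_le_coe, if_true, Set.Icc.coe_mul]
    nlinarith [w.2.2]
  · simp only [Bool.true_eq_false, iff_false, not_le]
    exact (low_lt h0 hx).trans_le (le_high h1 w)

/-- Two points on the same side are separated neither by the head nor by points of the other side,
so only the sequence of their own side matters. Infinitely many visits to each side ensure that this
whole sequence is used. -/
lemma prec_side_side {b : ℕ → Bool} (hb : ∀ c, {j | b j = c}.Infinite) (t : Bool)
    (u : Bool → ℕ → I) (s : Bool → ℕ → Bool) (c : Bool) {x y : I} (hx : x < 1) (hy : y < 1) :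
    Prec (gluePoints v b u) (glueSigns t b s) (side v c x) (side v c y) ↔
      Prec (u c) (s c) x y := by
  have hnth : ∀ k, b (Nat.nth (fun i => b i = c) k) = c := fun k =>
    Nat.nth_mem_of_infinite (p := fun i => b i = c) (hb c) k
  have hcount : ∀ k, Nat.count (fun i => b i = c) (Nat.nth (fun i => b i = c) k) = k := fun k =>
    Nat.count_nth_of_infinite (p := fun i => b i = c) (hb c) k
  -- The `k`-th term of the sequence `u c` sits at the `k`-th index where `b` equals `c`, shifted by
  -- one because of the head.
  refine prec_iff_of_reindex (n := fun k => Nat.nth (fun i => b i = c) k + 1) ?_ ?_ ?_ ?_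
    (side_lt_side h0 h1 c x y) (side_lt_side h0 h1 c y x)
  · exact fun k l h => Nat.succ_lt_succ (Nat.nth_strictMono (hb c) h)
  · intro k
    simp only [gluePoints, interleave, hnth, hcount, mem_Ioc_min_max_iff, side_le_side h0 h1]
  · intro j hj
    cases j with
    | zero =>
      rw [mem_Ioc_min_max_iff, gluePoints, le_side_iff h0 h1 c hx, le_side_iff h0 h1 c hy] at hj
      exact absurd Iff.rfl hj
    | succ j =>
      by_cases hjc : b j = c
      · exact ⟨Nat.count (fun i => b i = c) j, by
          rw [Nat.nth_count (p := fun i => b i = c) hjc]⟩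
      · rw [mem_Ioc_min_max_iff, gluePoints, side_le_side_of_ne h0 h1 hjc hx,
          side_le_side_of_ne h0 h1 hjc hy] at hj
        exact absurd Iff.rfl hj
  · intro k
    simp only [glueSigns, interleave, hnth, hcount]

lemma head_mem_Ioc (b : ℕ → Bool) (u : Bool → ℕ → I) {x : I} (y : I) (hx : x < 1) :
    gluePoints v b u 0 ∈ Set.Ioc (side v true x) (side v false y) :=
  ⟨low_lt h0 hx, le_high h1 y⟩

lemma prec_low_high (b : ℕ → Bool) (t : Bool) (u : Bool → ℕ → I) (s : Bool → ℕ → Bool)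
    {x : I} (y : I) (hx : x < 1) :
    Prec (gluePoints v b u) (glueSigns t b s) (side v true x) (side v false y) ↔ t = true := by
  have hlt : side v true x < side v false y := (low_lt h0 hx).trans_le (le_high h1 y)
  rw [prec_iff_of_separated_by_head]
  · simp [glueSigns, hlt, hlt.le]
  · rw [min_eq_left hlt.le, max_eq_right hlt.le]
    exact head_mem_Ioc h0 h1 b u y hx

lemma prec_high_low (b : ℕ → Bool) (t : Bool) (u : Bool → ℕ → I) (s : Bool → ℕ → Bool)
    {x : I} (y : I) (hx : x < 1) :
    Prec (gluePoints v b u) (glueSigns t b s) (side v false y) (side v true x) ↔ t = false := by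
  have hlt : side v true x < side v false y := (low_lt h0 hx).trans_le (le_high h1 y)
  rw [prec_iff_of_separated_by_head]
  · simp [glueSigns, hlt, hlt.le]
  · rw [min_eq_right hlt.le, max_eq_left hlt.le]
    exact head_mem_Ioc h0 h1 b u y hx

end Side

lemma measurable_side (v : I) (c : Bool) : Measurable (side v c) := by
  cases c
  · exact measurable_highMap.comp (by fun_prop : Measurable fun x : I => (v, x))
  · exact measurable_lowMap.comp (by fun_prop : Measurable fun x : I => (v, x))

lemma volume_eq_side (v : I) : (volume : Measure I)
    = ENNReal.ofReal v • (volume : Measure I).map (side v true)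
      + ENNReal.ofReal (1 - v) • (volume : Measure I).map (side v false) :=
  (volume_split v).symm

lemma volume_real_eq_side (v : I) {A : Set I} (hA : MeasurableSet A) :
    (volume : Measure I).real A = v * (volume : Measure I).real (side v true ⁻¹' A)
      + (1 - v) * (volume : Measure I).real (side v false ⁻¹' A) := by
  conv_lhs => rw [volume_eq_side v]
  have h1 : (0 : ℝ) ≤ 1 - v := by linarith [v.2.2]
  rw [measureReal_def, Measure.add_apply, Measure.smul_apply, Measure.smul_apply,
    Measure.map_apply (measurable_side v _) hA, Measure.map_apply (measurable_side v _) hA,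
    smul_eq_mul, smul_eq_mul, ENNReal.toReal_add (by finiteness) (by finiteness),
    ENNReal.toReal_mul, ENNReal.toReal_mul, ENNReal.toReal_ofReal v.2.1, ENNReal.toReal_ofReal h1]
  rfl

lemma ae_lt_one : ∀ᵐ x : I, x < 1 := by
  rw [ae_iff]
  have : {x : I | ¬x < 1} = {1} := by
    ext x
    simpa using ⟨fun h => le_antisymm x.2.2 (by exact_mod_cast h), fun h => h.ge⟩
  rw [this]
  simp

section Phi

variable {v : I} (h0 : 0 < v) (h1 : v < 1) {b : ℕ → Bool} (hb : ∀ c, {j | b j = c}.Infinite)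
  (t : Bool) (u : Bool → ℕ → I) (s : Bool → ℕ → Bool)
include h0 h1 hb

/-- The predecessors of a lower point are the copies of its predecessors within the lower part, of
mass scaled by `v`, and, if the sign is `⊖`, the whole upper part, of mass `1 - v`. -/
lemma phi_low {x : I} (hx : x < 1) :
    phi (gluePoints v b u) (glueSigns t b s) (side v true x)
      = if t then lowMap v (phi (u true) (s true) x)
        else highMap (unitInterval.symm v) (phi (u true) (s true) x) := by
  have e1 : (volume : Measure I).real
      (side v true ⁻¹' {y | Prec (gluePoints v b u) (glueSigns t b s) y (side v true x)})
      = phi (u true) (s true) x := by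
    refine measureReal_congr ?_
    filter_upwards [ae_lt_one] with y hy
    exact propext (prec_side_side h0 h1 hb t u s true hy hx)
  have e2 : side v false ⁻¹' {y | Prec (gluePoints v b u) (glueSigns t b s) y (side v true x)}
      = {_y | t = false} := by
    ext y
    exact prec_high_low h0 h1 b t u s y hx
  apply Subtype.ext
  rw [phi]
  simp only
  rw [volume_real_eq_side v (measurableSet_prec_left _ _ _), e1, e2]
  cases t <;> simp [lowMap, highMap]
  ring

lemma phi_high {x : I} (hx : x < 1) :
    phi (gluePoints v b u) (glueSigns t b s) (side v false x)
      = if t then highMap v (phi (u false) (s false) x)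
        else lowMap (unitInterval.symm v) (phi (u false) (s false) x) := by
  have e1 : (volume : Measure I).real
      (side v false ⁻¹' {y | Prec (gluePoints v b u) (glueSigns t b s) y (side v false x)})
      = phi (u false) (s false) x := by
    refine measureReal_congr ?_
    filter_upwards [ae_lt_one] with y hy
    exact propext (prec_side_side h0 h1 hb t u s false hy hx)
  have e2 : (volume : Measure I).real
      (side v true ⁻¹' {y | Prec (gluePoints v b u) (glueSigns t b s) y (side v false x)})
      = (volume : Measure I).real {_y : I | t = true} := by
    refine measureReal_congr ?_
    filter_upwards [ae_lt_one] with y hy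
    exact propext (prec_low_high h0 h1 b t u s x hy)
  apply Subtype.ext
  rw [phi]
  simp only
  rw [volume_real_eq_side v (measurableSet_prec_left _ _ _), e1, e2]
  cases t <;> simp [lowMap, highMap]

/-- Gluing the points and signs amounts to gluing the measures. -/
lemma phiMeasure_glue :
    phiMeasure (gluePoints v b u) (glueSigns t b s)
      = glueMeasure v t (phiMeasure (u true) (s true)) (phiMeasure (u false) (s false)) := by
  have hL : Measurable (leftMap v t) := measurable_leftMap.comp (by fun_prop :
    Measurable fun z : I × I => ((v, t), z))
  have hR : Measurable (rightMap v t) := measurable_rightMap.comp (by fun_prop :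
    Measurable fun z : I × I => ((v, t), z))
  have hg : ∀ (u : ℕ → I) (s : ℕ → Bool), Measurable fun x => (x, phi u s x) := fun u s =>
    measurable_id'.prodMk (measurable_phi_right u s)
  rw [glueMeasure, phiMeasure, phiMeasure, phiMeasure, Measure.map_map hL (hg _ _),
    Measure.map_map hR (hg _ _)]
  conv_lhs => rw [volume_eq_side v]
  rw [Measure.map_add _ _ (hg _ _), Measure.map_smul, Measure.map_smul,
    Measure.map_map (hg _ _) (measurable_side v _), Measure.map_map (hg _ _) (measurable_side v _)]
  congr 2
  · refine Measure.map_congr ?_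
    filter_upwards [ae_lt_one] with x hx
    exact Prod.ext rfl (phi_low h0 h1 hb t u s hx)
  · refine Measure.map_congr ?_
    filter_upwards [ae_lt_one] with x hx
    exact Prod.ext rfl (phi_high h0 h1 hb t u s hx)

end Phi


/-! ### A driving sequence assembled from two independent ones -/

section InfinitePi

variable {ι α β γ : Type*} [MeasurableSpace α] [MeasurableSpace β] [MeasurableSpace γ]

/-- Padding with the whole space lets cylinders with different supports be compared on a common one.
-/
lemma prod_union_ite_measure [DecidableEq ι] (μ : Measure α) [IsProbabilityMeasure μ]
    {s s' : Finset ι} (h : s ⊆ s') (A : ι → Set α) :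
    ∏ i ∈ s', μ (if i ∈ s then A i else Set.univ) = ∏ i ∈ s, μ (A i) := by
  rw [← Finset.prod_subset h fun i _ hi => by rw [if_neg hi, measure_univ]]
  exact Finset.prod_congr rfl fun i hi => by rw [if_pos hi]

/-- A sequence of independent pairs, each with independent entries, is a pair of independent
sequences. -/
lemma infinitePi_prod_map_unzip (μ : Measure α) (ν : Measure β) [IsProbabilityMeasure μ]
    [IsProbabilityMeasure ν] :
    (Measure.infinitePi fun _ : ι => μ.prod ν).map
      (fun w => ((fun i => (w i).1, fun i => (w i).2) : (ι → α) × (ι → β)))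
      = (Measure.infinitePi fun _ : ι => μ).prod (Measure.infinitePi fun _ : ι => ν) := by
  classical
  symm
  refine Measure.prod_eq_generateFrom
    (C := squareCylinders fun _ : ι => {s : Set α | MeasurableSet s})
    (D := squareCylinders fun _ : ι => {s : Set β | MeasurableSet s})
    generateFrom_squareCylinders generateFrom_squareCylinders
    (isPiSystem_squareCylinders (fun _ => MeasurableSpace.isPiSystem_measurableSet)
      fun _ => MeasurableSet.univ)
    (isPiSystem_squareCylinders (fun _ => MeasurableSpace.isPiSystem_measurableSet)
      fun _ => MeasurableSet.univ)
    ⟨fun _ => Set.univ, fun _ => ⟨∅, fun _ => Set.univ, fun _ _ => MeasurableSet.univ, by simp⟩,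
      by simp, Set.iUnion_const _⟩
    ⟨fun _ => Set.univ, fun _ => ⟨∅, fun _ => Set.univ, fun _ _ => MeasurableSet.univ, by simp⟩,
      by simp, Set.iUnion_const _⟩ ?_
  rintro _ ⟨s, A, hA, rfl⟩ _ ⟨s', B, hB, rfl⟩
  replace hA : ∀ i, MeasurableSet (A i) := fun i => hA i trivial
  replace hB : ∀ i, MeasurableSet (B i) := fun i => hB i trivial
  have hA' : ∀ i, MeasurableSet (if i ∈ s then A i else Set.univ) := fun i => by
    split_ifs
    exacts [hA i, MeasurableSet.univ]
  have hB' : ∀ i, MeasurableSet (if i ∈ s' then B i else Set.univ) := fun i => by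
    split_ifs
    exacts [hB i, MeasurableSet.univ]
  rw [Measure.map_apply (by fun_prop) ((MeasurableSet.pi s.countable_toSet fun i _ => hA i).prod
    (MeasurableSet.pi s'.countable_toSet fun i _ => hB i))]
  have e : (fun w : ι → α × β => ((fun i => (w i).1, fun i => (w i).2) : (ι → α) × (ι → β))) ⁻¹'
      ((s : Set ι).pi A ×ˢ (s' : Set ι).pi B)
      = ((s ∪ s' : Finset ι) : Set ι).pi fun i =>
        (if i ∈ s then A i else Set.univ) ×ˢ (if i ∈ s' then B i else Set.univ) := by
    ext w
    simp only [Set.mem_preimage, Set.mem_prod, Set.mem_pi, Finset.mem_coe, Finset.mem_union]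
    constructor
    · rintro ⟨h, h'⟩ i _
      constructor
      · split_ifs with hi
        exacts [h i hi, trivial]
      · split_ifs with hi
        exacts [h' i hi, trivial]
    · intro h
      exact ⟨fun i hi => by simpa [hi] using (h i (Or.inl hi)).1,
        fun i hi => by simpa [hi] using (h i (Or.inr hi)).2⟩
  rw [e, Measure.infinitePi_pi _ fun i _ => (hA' i).prod (hB' i)]
  simp_rw [Measure.prod_prod]
  rw [Finset.prod_mul_distrib, prod_union_ite_measure μ Finset.subset_union_left,
    prod_union_ite_measure ν Finset.subset_union_right, Measure.infinitePi_pi _ fun i _ => hA i,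
    Measure.infinitePi_pi _ fun i _ => hB i]

lemma measurePreserving_zip (μ : Measure α) (ν : Measure β) [IsProbabilityMeasure μ]
    [IsProbabilityMeasure ν] :
    MeasurePreserving (fun (q : (ι → α) × (ι → β)) i => (q.1 i, q.2 i))
      ((Measure.infinitePi fun _ : ι => μ).prod (Measure.infinitePi fun _ : ι => ν))
      (Measure.infinitePi fun _ : ι => μ.prod ν) := by
  refine ⟨by fun_prop, ?_⟩
  rw [← infinitePi_prod_map_unzip, Measure.map_map (by fun_prop) (by fun_prop)]
  exact Measure.map_id

/-- Prepend a term to a sequence. -/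
def consSeq (q : α × (ℕ → α)) : ℕ → α
  | 0 => q.1
  | j + 1 => q.2 j

lemma measurable_consSeq : Measurable (consSeq : α × (ℕ → α) → ℕ → α) := by
  refine measurable_pi_iff.2 fun j => ?_
  cases j with
  | zero => exact measurable_fst
  | succ j => exact (measurable_pi_apply j).comp measurable_snd

lemma measurePreserving_consSeq (μ : Measure α) [IsProbabilityMeasure μ] :
    MeasurePreserving consSeq (μ.prod (Measure.infinitePi fun _ : ℕ => μ))
      (Measure.infinitePi fun _ : ℕ => μ) := by
  classical
  refine ⟨measurable_consSeq, Measure.eq_infinitePi _ fun s t ht => ?_⟩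
  rw [Measure.map_apply measurable_consSeq (MeasurableSet.pi s.countable_toSet fun i _ => ht i)]
  have ht' : ∀ i, MeasurableSet (if i ∈ s then t i else Set.univ) := fun i => by
    split_ifs
    exacts [ht i, MeasurableSet.univ]
  obtain ⟨n, hn⟩ : ∃ n, s ⊆ Finset.range (n + 1) :=
    ⟨s.sup id, fun i hi => Finset.mem_range.2 (Nat.lt_succ_of_le (Finset.le_sup (f := id) hi))⟩
  have e : consSeq ⁻¹' (s : Set ℕ).pi t = (if 0 ∈ s then t 0 else Set.univ) ×ˢ
      ((Finset.range n : Finset ℕ) : Set ℕ).pi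
        fun i => if i + 1 ∈ s then t (i + 1) else Set.univ := by
    ext q
    simp only [Set.mem_preimage, Set.mem_prod, Set.mem_pi, Finset.mem_coe, Finset.mem_range]
    constructor
    · intro h
      constructor
      · split_ifs with hi
        exacts [h 0 hi, trivial]
      · intro i _
        split_ifs with hi
        exacts [h (i + 1) hi, trivial]
    · rintro ⟨h, h'⟩ i hi
      cases i with
      | zero => rwa [if_pos hi] at h
      | succ i =>
        have := h' i (by simpa using hn hi)
        rwa [if_pos hi] at this
  rw [e, Measure.prod_prod, Measure.infinitePi_pi _ fun i _ => ht' (i + 1),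
    ← prod_union_ite_measure μ hn, Finset.prod_range_succ', mul_comm]

/-- For fixed `b`, interleaving reads an i.i.d. family indexed by `Bool × ℕ` along an injection:
within one value of `b` the counter strictly increases. The law obtained does not depend on `b`. -/
lemma measurePreserving_interleave (μ : Measure γ) [IsProbabilityMeasure μ] (b : ℕ → Bool) :
    MeasurePreserving (interleave b)
      (Measure.infinitePi fun _ : Bool => Measure.infinitePi fun _ : ℕ => μ)
      (Measure.infinitePi fun _ : ℕ => μ) := by
  refine ⟨measurable_pi_iff.2 fun j => by unfold interleave; fun_prop, ?_⟩
  have hinj : Function.Injective fun j => (b j, Nat.count (fun i => b i = b j) j) := by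
    intro i j h
    obtain ⟨h1, h2⟩ := Prod.mk.inj h
    have : Nat.count (fun k => b k = b j) i = Nat.count (fun k => b k = b j) j := by
      rw [← h2, h1]
    exact Nat.count_injective (p := fun k => b k = b j) h1 rfl this
  have h := Measure.map_infinitePi_infinitePi_of_inj (P := fun _ : Bool × ℕ => μ) hinj
  rw [← Measure.infinitePi_map_curry_symm (fun _ : Bool => fun _ : ℕ => μ),
    Measure.map_map (by fun_prop) (by fun_prop)] at h
  exact h

lemma measurable_interleave :
    Measurable fun q : (ℕ → Bool) × (Bool → ℕ → γ) => interleave q.1 q.2 := by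
  refine measurable_pi_iff.2 fun j => ?_
  have h1 : Measurable fun w : (Bool → ℕ → γ) × (Bool × ℕ) => w.1 w.2.1 w.2.2 :=
    measurable_from_prod_countable_left fun w =>
      (measurable_pi_apply w.2).comp (measurable_pi_apply w.1)
  have h2 : Measurable fun b : ℕ → Bool => Nat.count (fun i => b i = b j) j := by
    simp_rw [Nat.count_eq_card_filter_range, Finset.card_filter]
    refine Finset.measurable_sum _ fun i _ => Measurable.ite ?_ measurable_const measurable_const
    exact measurableSet_eq_fun (by fun_prop) (by fun_prop)
  exact h1.comp (measurable_snd.prodMk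
    (((measurable_pi_apply j).comp measurable_fst).prodMk (h2.comp measurable_fst)))

end InfinitePi

lemma measurable_side_uncurry : Measurable fun q : (I × Bool) × I => side q.1.1 q.1.2 q.2 :=
  Measurable.ite (measurableSet_eq_fun (by fun_prop) measurable_const)
    (measurable_lowMap.comp (by fun_prop : Measurable fun q : (I × Bool) × I => (q.1.1, q.2)))
    (measurable_highMap.comp (by fun_prop : Measurable fun q : (I × Bool) × I => (q.1.1, q.2)))

lemma measurable_decide_le : Measurable fun q : I × I => decide (q.1 ≤ q.2) :=
  measurable_to_bool (by
    have : (fun q : I × I => decide (q.1 ≤ q.2)) ⁻¹' {true} = {q | q.1 ≤ q.2} := by ext; simp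
    rw [this]
    exact measurableSet_le measurable_fst measurable_snd)

/-- The coin `r ≤ v` chooses `[0,v]` with probability `v`; a uniform point of the chosen interval is
then uniform in `[0,1]`. -/
lemma measurePreserving_side (v : I) :
    MeasurePreserving (fun q : I × I => side v (decide (q.1 ≤ v)) q.2)
      ((volume : Measure I).prod volume) volume := by
  have hm : Measurable fun q : I × I => side v (decide (q.1 ≤ v)) q.2 :=
    measurable_side_uncurry.comp (((measurable_const (a := v)).prodMk (measurable_decide_le.comp
      (measurable_fst.prodMk measurable_const))).prodMk measurable_snd)
  refine ⟨hm, Measure.ext fun A hA => ?_⟩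
  rw [Measure.map_apply hm hA, Measure.prod_apply (hm hA)]
  have e : ∀ r : I, (volume : Measure I)
      (Prod.mk r ⁻¹' ((fun q : I × I => side v (decide (q.1 ≤ v)) q.2) ⁻¹' A))
      = (Set.Iic v).indicator (fun _ => (volume : Measure I) (side v true ⁻¹' A)) r
        + (Set.Ioi v).indicator (fun _ => (volume : Measure I) (side v false ⁻¹' A)) r := by
    intro r
    by_cases h : r ≤ v
    · have h' : ¬v < r := not_lt.2 h
      simp only [Set.indicator, Set.mem_Iic, h, Set.mem_Ioi, h', if_true, if_false, add_zero]
      congr 1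
      ext x
      simp [h]
    · have h' : v < r := not_le.1 h
      simp only [Set.indicator, Set.mem_Iic, h, Set.mem_Ioi, h', if_true, if_false, zero_add]
      congr 1
      ext x
      simp [h]
  simp_rw [e]
  rw [lintegral_add_left (measurable_const.indicator measurableSet_Iic),
    lintegral_indicator_const measurableSet_Iic, lintegral_indicator_const measurableSet_Ioi,
    unitInterval.volume_Iic, unitInterval.volume_Ioi]
  conv_rhs => rw [volume_eq_side v]
  rw [Measure.add_apply, Measure.smul_apply, Measure.smul_apply,
    Measure.map_apply (measurable_side v _) hA, Measure.map_apply (measurable_side v _) hA,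
    smul_eq_mul, smul_eq_mul, mul_comm, mul_comm (ENNReal.ofReal (1 - v))]

/-- The joint law of a uniform point and a random sign. -/
noncomputable def markLaw (p : I) : Measure (I × Bool) := (volume : Measure I).prod (signLaw p)

instance (p : I) : IsProbabilityMeasure (markLaw p) := by unfold markLaw; infer_instance

/-- The law of an i.i.d. sequence of uniform points with random signs. -/
noncomputable def drivingLaw (p : I) : Measure (ℕ → I × Bool) :=
  Measure.infinitePi fun _ => markLaw p

instance (p : I) : IsProbabilityMeasure (drivingLaw p) := by unfold drivingLaw; infer_instance

/-- The law of an i.i.d. sequence of uniform points. -/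
noncomputable abbrev uniformSeqLaw : Measure (ℕ → I) :=
  Measure.infinitePi fun _ => (volume : Measure I)

lemma measurePreserving_sideMark (p v : I) :
    MeasurePreserving (fun q : I × (I × Bool) => (side v (decide (q.1 ≤ v)) q.2.1, q.2.2))
      ((volume : Measure I).prod (markLaw p)) (markLaw p) :=
  ((measurePreserving_side v).prod (MeasurePreserving.id (signLaw p))).comp
    (measurePreserving_prodAssoc (volume : Measure I) (volume : Measure I) (signLaw p)).symm

/-- Merge two sequences of marked points, the side of the next point being decided by comparing
`r j` to `v`. -/
noncomputable def mergeSeq (v : I) (q : (Bool → ℕ → I × Bool) × (ℕ → I)) (j : ℕ) : I × Bool :=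
  (side v (decide (q.2 j ≤ v)) (interleave (fun i => decide (q.2 i ≤ v)) q.1 j).1,
    (interleave (fun i => decide (q.2 i ≤ v)) q.1 j).2)

lemma measurable_mergeSeq :
    Measurable fun w : I × ((Bool → ℕ → I × Bool) × (ℕ → I)) => mergeSeq w.1 w.2 := by
  have hb : Measurable fun w : I × ((Bool → ℕ → I × Bool) × (ℕ → I)) =>
      fun i => decide (w.2.2 i ≤ w.1) :=
    measurable_pi_iff.2 fun i => measurable_decide_le.comp (by fun_prop :
      Measurable fun w : I × ((Bool → ℕ → I × Bool) × (ℕ → I)) => (w.2.2 i, w.1))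
  have hi := measurable_interleave.comp (hb.prodMk (measurable_fst.comp measurable_snd))
  refine measurable_pi_iff.2 fun j => ?_
  have hij := (measurable_pi_apply j).comp hi
  exact (measurable_side_uncurry.comp ((measurable_fst.prodMk
    ((measurable_pi_apply j).comp hb)).prodMk (measurable_fst.comp hij))).prodMk
    (measurable_snd.comp hij)

lemma measurePreserving_mergeSeq (p v : I) :
    MeasurePreserving (mergeSeq v)
      ((Measure.infinitePi fun _ : Bool => drivingLaw p).prod uniformSeqLaw) (drivingLaw p) := by
  -- Given the coins, the interleaved sequence has a law that does not depend on them, so it is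
  -- independent of them. The remaining map then acts term by term on i.i.d. triples.
  have h1 : MeasurePreserving (fun q : (ℕ → I) × (Bool → ℕ → I × Bool) =>
      (q.1, interleave (fun i => decide (q.1 i ≤ v)) q.2))
      (uniformSeqLaw.prod (Measure.infinitePi fun _ : Bool => drivingLaw p))
      (uniformSeqLaw.prod (drivingLaw p)) := by
    refine (MeasurePreserving.id uniformSeqLaw).skew_product
      (g := fun r θ => interleave (fun i => decide (r i ≤ v)) θ) ?_
      (ae_of_all _ fun r => (measurePreserving_interleave (markLaw p) _).map_eq)
    refine measurable_interleave.comp (Measurable.prodMk ?_ measurable_snd)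
    exact measurable_pi_iff.2 fun i => measurable_decide_le.comp (by fun_prop :
      Measurable fun w : (ℕ → I) × (Bool → ℕ → I × Bool) => (w.1 i, v))
  have h2 := measurePreserving_zip (ι := ℕ) (volume : Measure I) (markLaw p)
  have h3 : MeasurePreserving (fun (w : ℕ → I × (I × Bool)) j =>
      (side v (decide ((w j).1 ≤ v)) (w j).2.1, (w j).2.2))
      (Measure.infinitePi fun _ : ℕ => (volume : Measure I).prod (markLaw p)) (drivingLaw p) := by
    have hm := (measurePreserving_sideMark p v).measurable
    refine ⟨measurable_pi_iff.2 fun j => hm.comp (measurable_pi_apply j), ?_⟩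
    have := Measure.infinitePi_map_pi (fun _ : ℕ => (volume : Measure I).prod (markLaw p))
      (f := fun _ q => (side v (decide (q.1 ≤ v)) q.2.1, q.2.2)) (fun _ => hm)
    rw [(measurePreserving_sideMark p v).map_eq] at this
    exact this
  exact h3.comp (h2.comp (h1.comp Measure.measurePreserving_swap))

/-- The driving sequence built from two driving sequences, a marked point and uniform coins. -/
noncomputable def glueSeq (w : ((Bool → ℕ → I × Bool) × (I × Bool)) × (ℕ → I)) : ℕ → I × Bool :=
  consSeq (w.1.2, mergeSeq w.1.2.1 (w.1.1, w.2))

lemma measurePreserving_glueSeq (p : I) :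
    MeasurePreserving glueSeq
      (((Measure.infinitePi fun _ : Bool => drivingLaw p).prod (markLaw p)).prod uniformSeqLaw)
      (drivingLaw p) := by
  have h1 := (Measure.measurePreserving_swap (μ := Measure.infinitePi fun _ : Bool => drivingLaw p)
    (ν := markLaw p)).prod (MeasurePreserving.id uniformSeqLaw)
  have h2 := measurePreserving_prodAssoc (markLaw p)
    (Measure.infinitePi fun _ : Bool => drivingLaw p) uniformSeqLaw
  have h3 := (MeasurePreserving.id (markLaw p)).skew_product
    (g := fun (m : I × Bool) q => mergeSeq m.1 q)
    (measurable_mergeSeq.comp ((measurable_fst.comp measurable_fst).prodMk measurable_snd))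
    (ae_of_all _ fun m => (measurePreserving_mergeSeq p m.1).map_eq)
  exact (measurePreserving_consSeq (markLaw p)).comp (h3.comp (h2.comp h1))

lemma glueSeq_fst (w : ((Bool → ℕ → I × Bool) × (I × Bool)) × (ℕ → I)) :
    (fun j => (glueSeq w j).1) = gluePoints w.1.2.1 (fun i => decide (w.2 i ≤ w.1.2.1))
      (fun c j => (w.1.1 c j).1) := by
  funext j
  cases j <;> rfl

lemma glueSeq_snd (w : ((Bool → ℕ → I × Bool) × (I × Bool)) × (ℕ → I)) :
    (fun j => (glueSeq w j).2) = glueSigns w.1.2.2 (fun i => decide (w.2 i ≤ w.1.2.1))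
      (fun c j => (w.1.1 c j).2) := by
  funext j
  cases j <;> rfl


/-! ### Contraction of `Φ_p` in the Wasserstein distance -/

lemma sqrt_scaled {c x y : ℝ} (hc : 0 ≤ c) :
    √((c * x) ^ 2 + (c * y) ^ 2) = c * √(x ^ 2 + y ^ 2) := by
  rw [show (c * x) ^ 2 + (c * y) ^ 2 = c ^ 2 * (x ^ 2 + y ^ 2) by ring,
    Real.sqrt_mul (sq_nonneg c), Real.sqrt_sq hc]

lemma squareDist_leftMap (v : I) (t : Bool) (a b : I × I) :
    squareDist (leftMap v t a) (leftMap v t b) = ENNReal.ofReal v * squareDist a b := by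
  rw [squareDist, squareDist, ← ENNReal.ofReal_mul v.2.1, ← sqrt_scaled v.2.1]
  congr 2
  refine congrArg₂ (fun x y : ℝ => x ^ 2 + y ^ 2) ?_ ?_
  · simp [leftMap, lowMap, mul_sub]
  · cases t <;> simp [leftMap, lowMap, highMap] <;> ring

lemma squareDist_rightMap (v : I) (t : Bool) (a b : I × I) :
    squareDist (rightMap v t a) (rightMap v t b) = ENNReal.ofReal (1 - v) * squareDist a b := by
  have hv : (0 : ℝ) ≤ 1 - v := by linarith [v.2.2]
  rw [squareDist, squareDist, ← ENNReal.ofReal_mul hv, ← sqrt_scaled hv]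
  congr 2
  refine congrArg₂ (fun x y : ℝ => x ^ 2 + y ^ 2) ?_ ?_
  · simp [rightMap, highMap, mul_sub]
  · cases t <;> simp [rightMap, lowMap, highMap] <;> ring

lemma measurable_squareDist : Measurable fun z : (I × I) × (I × I) => squareDist z.1 z.2 := by
  unfold squareDist
  fun_prop

lemma wasserstein_le {X : Type*} [MeasurableSpace X] {d : X → X → ℝ≥0∞}
    {μ ν : ProbabilityMeasure X} (γ : Measure (X × X)) (h1 : γ.map Prod.fst = μ)
    (h2 : γ.map Prod.snd = ν) : wasserstein d μ ν ≤ ∫⁻ z, d z.1 z.2 ∂γ :=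
  iInf_le (fun γ : {γ : Measure (X × X) // γ.map Prod.fst = μ ∧ γ.map Prod.snd = ν} =>
    ∫⁻ z, d z.1 z.2 ∂γ.1) ⟨γ, h1, h2⟩

instance nonempty_coupling {X : Type*} [MeasurableSpace X] (μ ν : ProbabilityMeasure X) :
    Nonempty {γ : Measure (X × X) // γ.map Prod.fst = μ ∧ γ.map Prod.snd = ν} :=
  ⟨⟨(μ : Measure X).prod ν, by simp [Measure.map_fst_prod], by simp [Measure.map_snd_prod]⟩⟩

/-- Any couplings of the two parts glue to a coupling of the results. One factor `v` is the weight
of the part and the other its scale. -/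
lemma permutonDist_glue_le (v : I) (t : Bool) (μ₀ μ₁ ν₀ ν₁ : Permuton) :
    permutonDist (glue v t μ₀ μ₁) (glue v t ν₀ ν₁)
      ≤ ENNReal.ofReal v ^ 2 * permutonDist μ₀ ν₀
        + ENNReal.ofReal (1 - v) ^ 2 * permutonDist μ₁ ν₁ := by
  have hL : Measurable (leftMap v t) := measurable_leftMap.comp (by fun_prop :
    Measurable fun z : I × I => ((v, t), z))
  have hR : Measurable (rightMap v t) := measurable_rightMap.comp (by fun_prop :
    Measurable fun z : I × I => ((v, t), z))
  conv_rhs => rw [permutonDist, permutonDist, wasserstein, wasserstein]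
  rw [ENNReal.mul_iInf' (by simp) fun _ => inferInstance,
    ENNReal.mul_iInf' (by simp) fun _ => inferInstance]
  refine ENNReal.le_iInf_add_iInf ?_
  rintro ⟨γ₀, h01, h02⟩ ⟨γ₁, h11, h12⟩
  have hLL := hL.prodMap hL
  have hRR := hR.prodMap hR
  refine (wasserstein_le (ENNReal.ofReal v • γ₀.map (Prod.map (leftMap v t) (leftMap v t))
    + ENNReal.ofReal (1 - v) • γ₁.map (Prod.map (rightMap v t) (rightMap v t))) ?_ ?_).trans ?_
  · rw [Measure.map_add _ _ measurable_fst, Measure.map_smul, Measure.map_smul,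
      Measure.map_map measurable_fst hLL, Measure.map_map measurable_fst hRR]
    change ENNReal.ofReal v • γ₀.map (leftMap v t ∘ Prod.fst)
      + ENNReal.ofReal (1 - v) • γ₁.map (rightMap v t ∘ Prod.fst) = _
    rw [← Measure.map_map hL measurable_fst, ← Measure.map_map hR measurable_fst, h01, h11]
    rfl
  · rw [Measure.map_add _ _ measurable_snd, Measure.map_smul, Measure.map_smul,
      Measure.map_map measurable_snd hLL, Measure.map_map measurable_snd hRR]
    change ENNReal.ofReal v • γ₀.map (leftMap v t ∘ Prod.snd)
      + ENNReal.ofReal (1 - v) • γ₁.map (rightMap v t ∘ Prod.snd) = _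
    rw [← Measure.map_map hL measurable_snd, ← Measure.map_map hR measurable_snd, h02, h12]
    rfl
  · rw [lintegral_add_measure, lintegral_smul_measure, lintegral_smul_measure,
      lintegral_map measurable_squareDist hLL, lintegral_map measurable_squareDist hRR]
    simp only [Prod.map_fst, Prod.map_snd, squareDist_leftMap, squareDist_rightMap]
    rw [lintegral_const_mul _ measurable_squareDist, lintegral_const_mul _ measurable_squareDist,
      smul_eq_mul, smul_eq_mul, ← mul_assoc, ← mul_assoc, sq, sq]

/-- Second moment of the rank in the usual order of `[0,1]`. -/
lemma lintegral_ofReal_sq : ∫⁻ v : I, ENNReal.ofReal v ^ 2 = 3⁻¹ := by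
  have h := lintegral_rank_pow (m := (volume : Measure I)) (a := fun x : I => x)
    Function.injective_id (measurableSet_lt measurable_fst measurable_snd) 2 Set.univ
    MeasurableSet.univ (by simp)
  have e : ∀ x : I, (volume : Measure I) {y | y < x} = ENNReal.ofReal x := fun x =>
    unitInterval.volume_Iio x
  simp only [e, Measure.restrict_univ, measure_univ, one_pow] at h
  refine ENNReal.eq_inv_of_mul_eq_one_left ?_
  rw [mul_comm, ← h]
  norm_num

lemma lintegral_ofReal_one_sub_sq : ∫⁻ v : I, ENNReal.ofReal (1 - v) ^ 2 = 3⁻¹ := by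
  rw [← lintegral_ofReal_sq, ← unitInterval.measurePreserving_symm.lintegral_comp (by fun_prop)]
  simp

lemma lintegral_permutonDist_glue_le (p : I) (μ₀ μ₁ ν₀ ν₁ : Permuton) :
    ∫⁻ m, permutonDist (glue m.1 m.2 μ₀ μ₁) (glue m.1 m.2 ν₀ ν₁) ∂markLaw p
      ≤ 3⁻¹ * permutonDist μ₀ ν₀ + 3⁻¹ * permutonDist μ₁ ν₁ := by
  have h : ∀ m : I × Bool, permutonDist (glue m.1 m.2 μ₀ μ₁) (glue m.1 m.2 ν₀ ν₁)
      ≤ ENNReal.ofReal m.1 ^ 2 * permutonDist μ₀ ν₀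
        + ENNReal.ofReal (1 - m.1) ^ 2 * permutonDist μ₁ ν₁ :=
    fun m => permutonDist_glue_le m.1 m.2 μ₀ μ₁ ν₀ ν₁
  refine (lintegral_mono h).trans ?_
  generalize permutonDist μ₀ ν₀ = d₀
  generalize permutonDist μ₁ ν₁ = d₁
  have e : ∀ f : I → ℝ≥0∞, Measurable f → ∫⁻ m, f m.1 ∂markLaw p = ∫⁻ v, f v := by
    intro f hf
    rw [← lintegral_map hf measurable_fst, markLaw, Measure.map_fst_prod, measure_univ, one_smul]
  rw [lintegral_add_left (by fun_prop), lintegral_mul_const _ (by fun_prop),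
    lintegral_mul_const _ (by fun_prop), e (fun v => ENNReal.ofReal v ^ 2) (by fun_prop),
    e (fun v => ENNReal.ofReal (1 - v) ^ 2) (by fun_prop), lintegral_ofReal_sq,
    lintegral_ofReal_one_sub_sq]

lemma measurable_glue_comp {Z : Type*} [MeasurableSpace Z] {f g : Z → Permuton}
    {m : Z → I × Bool} (hf : Measurable f) (hg : Measurable g) (hm : Measurable m) :
    Measurable fun z => glue (m z).1 (m z).2 (f z) (g z) := by
  have h := measurable_glue.comp ((hf.prodMk hg).prodMk hm)
  exact h

lemma coe_Phi (p : I) (Q : ProbabilityMeasure Permuton) :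
    (Phi p Q : Measure Permuton)
      = (((Q : Measure Permuton).prod (Q : Measure Permuton)).prod (markLaw p)).map
        fun z : (Permuton × Permuton) × (I × Bool) => glue z.2.1 z.2.2 z.1.1 z.1.2 :=
  rfl

/-- With `f` a projection of a coupling `γ`, this computes the marginals of the glued coupling. -/
lemma map_glue_coupling {Z : Type*} [MeasurableSpace Z] {γ : Measure Z} [IsProbabilityMeasure γ]
    (p : I) (S : ProbabilityMeasure Permuton) {f : Z → Permuton} (hf : Measurable f)
    (hS : γ.map f = S) :
    ((γ.prod γ).prod (markLaw p)).map (fun w => glue w.2.1 w.2.2 (f w.1.1) (f w.1.2))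
      = Phi p S := by
  have h : MeasurePreserving f γ (S : Measure Permuton) := ⟨hf, hS⟩
  have hh := (h.prod h).prod (MeasurePreserving.id (markLaw p))
  have h' := hh.map_eq
  have h3 := Measure.map_map (μ := (γ.prod γ).prod (markLaw p)) measurable_glue hh.measurable
  rw [h'] at h3
  rw [coe_Phi, h3]
  rfl

/-- Glue two pairs of permutons at the same point with the same sign. -/
noncomputable def gluePair (w : ((Permuton × Permuton) × (Permuton × Permuton)) × (I × Bool)) :
    Permuton × Permuton :=
  (glue w.2.1 w.2.2 w.1.1.1 w.1.2.1, glue w.2.1 w.2.2 w.1.1.2 w.1.2.2)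

lemma measurable_gluePair : Measurable gluePair := by
  have h1 := measurable_glue_comp
    (Z := ((Permuton × Permuton) × (Permuton × Permuton)) × (I × Bool))
    (f := fun w => w.1.1.1) (g := fun w => w.1.2.1) (m := fun w => w.2)
    (by fun_prop) (by fun_prop) (by fun_prop)
  have h2 := measurable_glue_comp
    (Z := ((Permuton × Permuton) × (Permuton × Permuton)) × (I × Bool))
    (f := fun w => w.1.1.2) (g := fun w => w.1.2.2) (m := fun w => w.2)
    (by fun_prop) (by fun_prop) (by fun_prop)
  exact h1.prodMk h2

lemma lintegral_permutonDist_gluePair_le (p : I) (γ : Measure (Permuton × Permuton))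
    [IsProbabilityMeasure γ] :
    ∫⁻ z, permutonDist z.1 z.2 ∂(((γ.prod γ).prod (markLaw p)).map gluePair)
      ≤ 2 / 3 * ∫⁻ z, permutonDist z.1 z.2 ∂γ := by
  have h3 : (3⁻¹ : ℝ≥0∞) ≠ ∞ := by simp
  have hle : ∀ z : (Permuton × Permuton) × (Permuton × Permuton),
      ∫⁻ m, permutonDist (gluePair (z, m)).1 (gluePair (z, m)).2 ∂markLaw p
        ≤ 3⁻¹ * permutonDist z.1.1 z.1.2 + 3⁻¹ * permutonDist z.2.1 z.2.2 :=
    fun z => lintegral_permutonDist_glue_le p z.1.1 z.2.1 z.1.2 z.2.2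
  -- Only upper bounds are needed, and these inequalities hold for arbitrary integrands, so
  -- `permutonDist` need not be measurable. Below, each sum of integrands has a constant term in the
  -- variable of integration, which is enough to split it.
  refine (lintegral_map_le _ _).trans ((lintegral_prod_le _).trans ((lintegral_mono hle).trans
    ((lintegral_prod_le _).trans (le_of_eq ?_))))
  generalize permutonDist = d
  simp_rw [lintegral_add_left measurable_const, lintegral_const_mul' _ _ h3]
  rw [lintegral_add_right _ measurable_const, lintegral_const_mul' _ _ h3]
  simp only [lintegral_const, measure_univ, mul_one]
  rw [← two_mul, ← mul_assoc, div_eq_mul_inv]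

/-- The map `Φ_p` is a contraction. -/
lemma lawDist_Phi_le (p : I) (Q R : ProbabilityMeasure Permuton) :
    lawDist (Phi p Q) (Phi p R) ≤ 2 / 3 * lawDist Q R := by
  conv_rhs => rw [lawDist, wasserstein]
  rw [ENNReal.mul_iInf_of_ne (by simp [ENNReal.div_eq_zero_iff])
    (by simp [ENNReal.div_eq_top])]
  refine le_iInf fun ⟨γ, h1, h2⟩ => ?_
  have hγ : IsProbabilityMeasure γ := by
    constructor
    have := congrArg (fun m : Measure Permuton => m Set.univ) h1
    simpa [Measure.map_apply measurable_fst MeasurableSet.univ] using this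
  -- Two independent pairs drawn from the coupling `γ`, glued at a common point with a common sign.
  refine (wasserstein_le (((γ.prod γ).prod (markLaw p)).map gluePair) ?_ ?_).trans
    (lintegral_permutonDist_gluePair_le p γ)
  · rw [Measure.map_map measurable_fst measurable_gluePair]
    exact map_glue_coupling p Q measurable_fst h1
  · rw [Measure.map_map measurable_snd measurable_gluePair]
    exact map_glue_coupling p R measurable_snd h2


/-! ### Lipschitz test functions and uniqueness of the fixed point -/

/-- Real-valued Lipschitz functions on the unit square. -/
abbrev LipFun : Type := {f : I × I → ℝ // ∃ K, LipschitzWith K f}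

lemma LipFun.continuous (f : LipFun) : Continuous f.1 := f.2.choose_spec.continuous

lemma LipFun.integrable (f : LipFun) (μ : Measure (I × I)) [IsFiniteMeasure μ] :
    Integrable f.1 μ :=
  f.continuous.integrable_of_hasCompactSupport (HasCompactSupport.of_compactSpace f.1)

/-- The integrals of a permuton against all Lipschitz functions. -/
noncomputable def lipIntegrals (μ : Permuton) (f : LipFun) : ℝ :=
  ∫ x, f.1 x ∂(μ.1 : Measure (I × I))

lemma measurable_permuton_coe : Measurable fun μ : Permuton => (μ.1 : Measure (I × I)) :=
  measurable_subtype_coe.comp measurable_subtype_coe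

lemma measurable_permuton_of_coe {Z : Type*} [MeasurableSpace Z] {h : Z → Permuton}
    (H : Measurable fun z => ((h z).1 : Measure (I × I))) : Measurable h :=
  measurable_comap_iff.2 (measurable_comap_iff.2 H)

lemma measurable_lipIntegrals : Measurable lipIntegrals := by
  refine measurable_pi_iff.2 fun f => ?_
  let κ : Kernel Permuton (I × I) := ⟨fun μ => (μ.1 : Measure (I × I)), measurable_permuton_coe⟩
  exact (StronglyMeasurable.integral_kernel (κ := κ) f.continuous.stronglyMeasurable).measurable

/-- Thickened indicators of a closed set are Lipschitz and their integrals converge to its measure;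
closed sets form a generating π-system. -/
lemma measurable_of_lipIntegrals {Z : Type*} [MeasurableSpace Z] {h : Z → Permuton}
    (H : Measurable fun z => lipIntegrals (h z)) : Measurable h := by
  refine measurable_permuton_of_coe ?_
  have : ∀ z, IsProbabilityMeasure ((h z).1 : Measure (I × I)) := fun z => (h z).1.2
  refine Measurable.measure_of_isPiSystem_of_isProbabilityMeasure
    (S := {s | IsClosed s}) (BorelSpace.measurable_eq.trans borel_eq_generateFrom_isClosed)
    isPiSystem_isClosed fun A hA => ?_
  have hreal : Measurable fun z => ((h z).1 : Measure (I × I)).real A := by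
    have hpos : ∀ n : ℕ, (0 : ℝ) < 1 / (n + 1) := fun n => Nat.one_div_pos_of_nat
    refine measurable_of_tendsto_metrizable (f := fun n z =>
      ∫ x, (thickenedIndicator (hpos n) A x : ℝ) ∂((h z).1 : Measure (I × I))) (fun n => ?_) ?_
    · exact (measurable_pi_apply (⟨fun x => (thickenedIndicator (hpos n) A x : ℝ),
        _, (lipschitzWith_thickenedIndicator (hpos n) A)⟩ : LipFun)).comp H
    · rw [tendsto_pi_nhds]
      exact fun z => tendsto_integral_thickenedIndicator_of_isClosed _ hA hpos
        tendsto_one_div_add_atTop_nhds_zero_nat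
  have e : (fun z => ((h z).1 : Measure (I × I)) A)
      = fun z => ENNReal.ofReal (((h z).1 : Measure (I × I)).real A) := by
    funext z
    rw [ofReal_measureReal]
  rw [e]
  exact hreal.ennreal_ofReal

/-- The law of a random permuton is determined by the joint law of its integrals against Lipschitz
functions. -/
lemma ext_of_map_lipIntegrals {Q R : Measure Permuton}
    (h : Q.map lipIntegrals = R.map lipIntegrals) : Q = R := by
  -- The identity is measurable from the σ-algebra generated by `lipIntegrals`, so every measurable
  -- set of permutons is a preimage under `lipIntegrals`.
  have hid : @Measurable Permuton Permuton (MeasurableSpace.comap lipIntegrals inferInstance)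
      inferInstance id :=
    @measurable_of_lipIntegrals Permuton (MeasurableSpace.comap lipIntegrals inferInstance) id
      (comap_measurable lipIntegrals)
  refine Measure.ext fun S hS => ?_
  obtain ⟨T, hT, hTS⟩ := hid hS
  change lipIntegrals ⁻¹' T = S at hTS
  rw [← hTS, ← Measure.map_apply measurable_lipIntegrals hT, h,
    Measure.map_apply measurable_lipIntegrals hT]

lemma enorm_sub_le_squareDist {f : I × I → ℝ} {K : NNReal} (hf : LipschitzWith K f) (a b : I × I) :
    ‖f a - f b‖ₑ ≤ K * squareDist a b := by
  rw [← edist_eq_enorm_sub]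
  refine (hf a b).trans (mul_le_mul_right ?_ _)
  rw [edist_dist, squareDist]
  refine ENNReal.ofReal_le_ofReal (Real.le_sqrt_of_sq_le ?_)
  rw [Prod.dist_eq]
  have h1 : dist a.1 b.1 ^ 2 = ((a.1 : ℝ) - b.1) ^ 2 := by
    rw [Subtype.dist_eq, Real.dist_eq, sq_abs]
  have h2 : dist a.2 b.2 ^ 2 = ((a.2 : ℝ) - b.2) ^ 2 := by
    rw [Subtype.dist_eq, Real.dist_eq, sq_abs]
  rcases max_choice (dist a.1 b.1) (dist a.2 b.2) with h | h <;> rw [h]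
  · rw [h1]; linarith [sq_nonneg ((a.2 : ℝ) - b.2)]
  · rw [h2]; linarith [sq_nonneg ((a.1 : ℝ) - b.1)]

/-- The easy half of Kantorovich duality: integrate `f x - f y` against any coupling. -/
lemma enorm_lipIntegrals_sub_le (f : LipFun) {K : NNReal} (hf : LipschitzWith K f.1)
    (μ ν : Permuton) : ‖lipIntegrals μ f - lipIntegrals ν f‖ₑ ≤ K * permutonDist μ ν := by
  rw [permutonDist, wasserstein, ENNReal.mul_iInf' (by simp) fun _ => inferInstance]
  refine le_iInf fun ⟨γ, h1, h2⟩ => ?_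
  have hfm : ∀ ρ : Measure (I × I), AEStronglyMeasurable f.1 ρ := fun ρ =>
    f.continuous.aestronglyMeasurable
  have i1 : Integrable (fun z : (I × I) × (I × I) => f.1 z.1) γ := by
    refine (integrable_map_measure (hfm _) measurable_fst.aemeasurable).1 ?_
    rw [h1]
    exact f.integrable _
  have i2 : Integrable (fun z : (I × I) × (I × I) => f.1 z.2) γ := by
    refine (integrable_map_measure (hfm _) measurable_snd.aemeasurable).1 ?_
    rw [h2]
    exact f.integrable _
  have e : lipIntegrals μ f - lipIntegrals ν f = ∫ z, (f.1 z.1 - f.1 z.2) ∂γ := by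
    rw [integral_sub i1 i2, lipIntegrals, lipIntegrals, ← h1, ← h2,
      integral_map measurable_fst.aemeasurable (hfm _),
      integral_map measurable_snd.aemeasurable (hfm _)]
  rw [e, ← lintegral_const_mul _ measurable_squareDist]
  exact (enorm_integral_le_lintegral_enorm _).trans
    (lintegral_mono fun z => enorm_sub_le_squareDist hf z.1 z.2)

lemma enorm_exp_sub_exp_le (x y : ℝ) :
    ‖Complex.exp (x * Complex.I) - Complex.exp (y * Complex.I)‖ₑ ≤ ‖x - y‖ₑ := by
  have e : Complex.exp (x * Complex.I) - Complex.exp (y * Complex.I)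
      = Complex.exp (y * Complex.I) * (Complex.exp (Complex.I * ((x - y : ℝ) : ℂ)) - 1) := by
    rw [mul_sub, ← Complex.exp_add, mul_one]
    congr 2
    push_cast
    ring
  rw [e, enorm_mul]
  have h1 : ‖Complex.exp (y * Complex.I)‖ₑ = 1 := by
    rw [← ofReal_norm, Complex.norm_exp_ofReal_mul_I, ENNReal.ofReal_one]
  rw [h1, one_mul]
  exact Real.enorm_exp_I_mul_ofReal_sub_one_le

/-- The functional `μ ↦ exp (i ∫ f dμ)` is Lipschitz for `permutonDist`, so its means under `Q` and
`R` differ by at most a constant times the cost of any coupling. No coupling of cost zero has to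
exist. -/
lemma integral_exp_eq_of_lawDist_eq_zero {Q R : ProbabilityMeasure Permuton}
    (h : lawDist Q R = 0) (f : LipFun) :
    ∫ μ, Complex.exp (lipIntegrals μ f * Complex.I) ∂(Q : Measure Permuton)
      = ∫ μ, Complex.exp (lipIntegrals μ f * Complex.I) ∂(R : Measure Permuton) := by
  obtain ⟨K, hK⟩ := f.2
  have hm : Measurable fun μ : Permuton => Complex.exp (lipIntegrals μ f * Complex.I) := by
    have := (measurable_pi_apply f).comp measurable_lipIntegrals
    exact Complex.measurable_exp.comp ((Complex.measurable_ofReal.comp this).mul_const _)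
  have hint : ∀ {Z : Type} [MeasurableSpace Z] (ρ : Measure Z) [IsFiniteMeasure ρ]
      (g : Z → Permuton), Measurable g →
      Integrable (fun z => Complex.exp (lipIntegrals (g z) f * Complex.I)) ρ := by
    intro Z _ ρ _ g hg
    refine Integrable.of_bound (hm.comp hg).aestronglyMeasurable 1 (ae_of_all _ fun z => ?_)
    rw [Complex.norm_exp_ofReal_mul_I]
  rw [← sub_eq_zero, ← enorm_eq_zero, ← nonpos_iff_eq_zero]
  have h0 : (K : ℝ≥0∞) * lawDist Q R = 0 := by rw [h, mul_zero]
  rw [← h0, lawDist, wasserstein, ENNReal.mul_iInf' (by simp) fun _ => inferInstance]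
  refine le_iInf fun ⟨γ, h1, h2⟩ => ?_
  have hγ : IsProbabilityMeasure γ := by
    constructor
    have := congrArg (fun m : Measure Permuton => m Set.univ) h1
    simpa [Measure.map_apply measurable_fst MeasurableSet.univ] using this
  change _ ≤ (K : ℝ≥0∞) * ∫⁻ z, permutonDist z.1 z.2 ∂γ
  rw [← h1, ← h2, integral_map measurable_fst.aemeasurable hm.aestronglyMeasurable,
    integral_map measurable_snd.aemeasurable hm.aestronglyMeasurable,
    ← integral_sub (hint γ Prod.fst measurable_fst) (hint γ Prod.snd measurable_snd)]
  refine (enorm_integral_le_lintegral_enorm _).trans ?_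
  rw [← lintegral_const_mul' _ _ (by simp)]
  exact lintegral_mono fun z => (enorm_exp_sub_exp_le _ _).trans
    (enorm_lipIntegrals_sub_le f hK z.1 z.2)

/-- It suffices to compare the finite-dimensional marginals of `lipIntegrals`, through their
characteristic functions. A linear combination of integrals of Lipschitz functions is the integral
of one Lipschitz function, so a single test function at a time is enough. -/
lemma eq_of_lawDist_eq_zero {Q R : ProbabilityMeasure Permuton} (h : lawDist Q R = 0) :
    Q = R := by
  suffices hmap : (Q : Measure Permuton).map lipIntegrals = (R : Measure Permuton).map lipIntegrals
    from Subtype.ext (ext_of_map_lipIntegrals hmap)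
  have hX := measurable_lipIntegrals
  have hfin : ∀ S : ProbabilityMeasure Permuton,
      IsProbabilityMeasure ((S : Measure Permuton).map lipIntegrals) := fun S =>
    Measure.isProbabilityMeasure_map hX.aemeasurable
  have hQ := hfin Q
  have hR := hfin R
  have hres : ∀ (J : Finset LipFun) (ρ : Measure (LipFun → ℝ)) [IsProbabilityMeasure ρ],
      IsProbabilityMeasure (ρ.map J.restrict) := fun J ρ _ =>
    Measure.isProbabilityMeasure_map (Finset.measurable_restrict J).aemeasurable
  have hresR : ∀ J : Finset LipFun,
      IsFiniteMeasure (((R : Measure Permuton).map lipIntegrals).map J.restrict) := fun J =>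
    have := hres J ((R : Measure Permuton).map lipIntegrals)
    inferInstance
  refine IsProjectiveLimit.unique
    (P := fun J : Finset LipFun => ((R : Measure Permuton).map lipIntegrals).map J.restrict)
    (fun J => ?_) (fun J => rfl)
  have hQJ := hres J ((Q : Measure Permuton).map lipIntegrals)
  refine Measure.ext_of_charFunDual (funext fun L => ?_)
  classical
  -- The functional `L` has coefficients `L (Pi.single j 1)`; `f` is the corresponding combination
  -- of test functions.
  let f : LipFun := ⟨fun x => ∑ j : J, L (Pi.single j 1) * j.1.1 x, by
    have hsum : ∀ s : Finset J,
        ∃ K, LipschitzWith K fun x : I × I => ∑ j ∈ s, L (Pi.single j 1) * j.1.1 x := by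
      intro s
      induction s using Finset.induction_on with
      | empty => exact ⟨0, by simp⟩
      | insert j s hj ih =>
        obtain ⟨K, hK⟩ := ih
        obtain ⟨K', hK'⟩ := j.1.2
        simp_rw [Finset.sum_insert hj]
        exact ⟨_, ((lipschitzWith_smul (L (Pi.single j 1))).comp hK').add hK⟩
    exact hsum Finset.univ⟩
  have hL : ∀ μ : Permuton, L (J.restrict (lipIntegrals μ)) = lipIntegrals μ f := by
    intro μ
    have h1 : lipIntegrals μ f = ∑ j : J, L (Pi.single j 1) * lipIntegrals μ j.1 := by
      unfold lipIntegrals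
      rw [integral_finsetSum _ fun j _ => (j.1.integrable _).const_mul _]
      simp_rw [integral_const_mul]
    rw [h1]
    have := LinearMap.pi_apply_eq_sum_univ L.toLinearMap (J.restrict (lipIntegrals μ))
    refine this.trans (Finset.sum_congr rfl fun j _ => ?_)
    rw [smul_eq_mul, mul_comm]
    have e : (fun i => if j = i then (1 : ℝ) else 0) = Pi.single j 1 := by
      funext i
      simp [Pi.single_apply, eq_comm]
    rw [e]
    rfl
  have hchar : ∀ S : ProbabilityMeasure Permuton,
      charFunDual (((S : Measure Permuton).map lipIntegrals).map J.restrict) L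
        = ∫ μ, Complex.exp (lipIntegrals μ f * Complex.I) ∂(S : Measure Permuton) := by
    intro S
    have hc : Continuous fun v : J → ℝ => Complex.exp (L v * Complex.I) := by fun_prop
    rw [charFunDual_apply, Measure.map_map (Finset.measurable_restrict J) hX,
      integral_map ((Finset.measurable_restrict J).comp hX).aemeasurable
        hc.aestronglyMeasurable]
    simp_rw [Function.comp_apply, hL]
  rw [hchar, hchar]
  exact integral_exp_eq_of_lawDist_eq_zero h f

lemma squareDist_le (a b : I × I) : squareDist a b ≤ 2 := by
  rw [squareDist, ← ENNReal.ofReal_ofNat]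
  refine ENNReal.ofReal_le_ofReal (Real.sqrt_le_iff.2 ⟨by norm_num, ?_⟩)
  have h1 : ∀ x y : I, ((x : ℝ) - y) ^ 2 ≤ 1 := fun x y => by
    rw [sq_le_one_iff_abs_le_one, abs_le]
    constructor <;> linarith [x.2.1, x.2.2, y.2.1, y.2.2]
  have := h1 a.1 b.1
  have := h1 a.2 b.2
  norm_num
  linarith

lemma wasserstein_le_of_forall_le {X : Type*} [MeasurableSpace X] {d : X → X → ℝ≥0∞} {c : ℝ≥0∞}
    (hd : ∀ a b, d a b ≤ c) (μ ν : ProbabilityMeasure X) : wasserstein d μ ν ≤ c := by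
  refine (wasserstein_le ((μ : Measure X).prod ν) (by simp [Measure.map_fst_prod])
    (by simp [Measure.map_snd_prod])).trans
    ((lintegral_mono (g := fun _ => c) fun z : X × X => hd z.1 z.2).trans ?_)
  simp

lemma lawDist_ne_top (Q R : ProbabilityMeasure Permuton) : lawDist Q R ≠ ∞ :=
  ne_top_of_le_ne_top (by simp : (2 : ℝ≥0∞) ≠ ∞) (wasserstein_le_of_forall_le
    (d := permutonDist) (fun μ ν => wasserstein_le_of_forall_le squareDist_le μ.1 ν.1) Q R)

/-- The map `Φ_p` has at most one fixed point. -/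
lemma Phi_fixed_unique (p : I) {Q R : ProbabilityMeasure Permuton} (hQ : Phi p Q = Q)
    (hR : Phi p R = R) : Q = R := by
  refine eq_of_lawDist_eq_zero ?_
  have h := lawDist_Phi_le p Q R
  rw [hQ, hR] at h
  by_contra hne
  have hlt : (2 / 3 : ℝ≥0∞) * lawDist Q R < 1 * lawDist Q R := by
    refine ENNReal.mul_lt_mul_left hne (lawDist_ne_top Q R) ?_
    rw [ENNReal.div_lt_iff (by simp) (by simp)]
    norm_num
  rw [one_mul] at hlt
  exact absurd h (not_le.2 hlt)


/-! ### The law of the recursive separable permuton and the fixed-point equation -/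

/-- The law of an i.i.d. sequence of random signs. -/
noncomputable abbrev signSeqLaw (p : I) : Measure (ℕ → Bool) :=
  Measure.infinitePi fun _ => signLaw p

lemma recPermuton_coe {u : ℕ → I} (hu : Separating u) (s : ℕ → Bool) :
    ((recPermuton u s).1 : Measure (I × I)) = phiMeasure u s := by
  rw [recPermuton, dif_pos (isPermuton_phiMeasure hu s)]
  rfl

/-- The recursive separable permuton, as a function of a pair of sequences. -/
noncomputable def recPair (q : (ℕ → I) × (ℕ → Bool)) : Permuton := recPermuton q.1 q.2

lemma aemeasurable_recPair (p : I) :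
    AEMeasurable recPair (uniformSeqLaw.prod (signSeqLaw p)) := by
  classical
  have hae : ∀ᵐ q ∂(uniformSeqLaw.prod (signSeqLaw p)), Separating q.1 :=
    Measure.quasiMeasurePreserving_fst.ae ae_separating
  -- A measurable null set outside which the points separate. Off `T` the permuton is `phiMeasure`,
  -- which is measurable in the sequences; on `T` the value is replaced by a constant.
  obtain ⟨T, hTs, hT, hT0⟩ := exists_measurable_superset_of_null (ae_iff.1 hae)
  have hsep : ∀ q ∉ T, Separating q.1 := fun q hq => by
    by_contra h
    exact hq (hTs h)
  refine ⟨fun q => if q ∈ T then diagonalPermuton else recPair q, ?_, ?_⟩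
  · refine measurable_permuton_of_coe ?_
    have e : (fun q : (ℕ → I) × (ℕ → Bool) =>
        ((if q ∈ T then diagonalPermuton else recPair q).1 : Measure (I × I)))
        = fun q => if q ∈ T then (diagonalPermuton.1 : Measure (I × I))
          else phiMeasure q.1 q.2 := by
      funext q
      split_ifs with h
      · rfl
      · exact recPermuton_coe (hsep q h) q.2
    rw [e]
    exact Measurable.ite hT measurable_const measurable_phiMeasure
  · have : ∀ᵐ q ∂(uniformSeqLaw.prod (signSeqLaw p)), q ∉ T := by
      rw [ae_iff]
      simpa using hT0
    filter_upwards [this] with q hq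
    rw [if_neg hq]

/-- The law of the recursive separable permuton. -/
noncomputable def recLaw (p : I) : ProbabilityMeasure Permuton :=
  ⟨(uniformSeqLaw.prod (signSeqLaw p)).map recPair,
    Measure.isProbabilityMeasure_map (aemeasurable_recPair p)⟩

lemma coe_recLaw (p : I) :
    (recLaw p : Measure Permuton) = (uniformSeqLaw.prod (signSeqLaw p)).map recPair :=
  rfl

/-- The points and the signs of a sequence of marked points. -/
def unzip (θ : ℕ → I × Bool) : (ℕ → I) × (ℕ → Bool) :=
  (fun j => (θ j).1, fun j => (θ j).2)

/-- The recursive separable permuton, as a function of the sequence of marked points. -/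
noncomputable def markPermuton (θ : ℕ → I × Bool) : Permuton :=
  recPair (unzip θ)

lemma markPermuton_coe {θ : ℕ → I × Bool} (h : Separating fun j => (θ j).1) :
    ((markPermuton θ).1 : Measure (I × I)) = phiMeasure (fun j => (θ j).1) fun j => (θ j).2 :=
  recPermuton_coe h _

lemma measurePreserving_unzip (p : I) :
    MeasurePreserving unzip (drivingLaw p) (uniformSeqLaw.prod (signSeqLaw p)) :=
  ⟨by unfold unzip; fun_prop, infinitePi_prod_map_unzip volume (signLaw p)⟩

lemma aemeasurable_markPermuton (p : I) : AEMeasurable markPermuton (drivingLaw p) :=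
  (aemeasurable_recPair p).comp_quasiMeasurePreserving
    (measurePreserving_unzip p).quasiMeasurePreserving

lemma map_markPermuton (p : I) : (drivingLaw p).map markPermuton = recLaw p := by
  have h := (measurePreserving_unzip p).map_eq
  have ha := aemeasurable_recPair p
  rw [coe_recLaw]
  rw [← h] at ha ⊢
  exact (AEMeasurable.map_map_of_aemeasurable ha (measurePreserving_unzip p).aemeasurable).symm

lemma ae_separating_mark (p : I) :
    ∀ᵐ θ ∂(drivingLaw p), Separating fun j => (θ j).1 :=
  (measurePreserving_unzip p).quasiMeasurePreserving.ae
    (Measure.quasiMeasurePreserving_fst.ae ae_separating)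

/-- Almost surely, for every level `v`, the coins `r j ≤ v` take both values infinitely often. -/
lemma ae_coins_infinite : ∀ᵐ r ∂uniformSeqLaw, ∀ v : I, 0 < v → v < 1 →
    ∀ c : Bool, {j | decide (r j ≤ v) = c}.Infinite := by
  obtain ⟨D, hDc, hDd⟩ := TopologicalSpace.exists_countable_dense I
  have h1 : ∀ᵐ r ∂uniformSeqLaw, ∀ a ∈ D, 0 < a → ∃ᶠ j in Filter.atTop, r j ∈ Set.Iic a := by
    rw [ae_ball_iff hDc]
    intro a _
    by_cases ha : 0 < a
    · filter_upwards [ae_frequently_mem volume (measurableSet_Iic (a := a)) (by simpa using ha)]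
        with r hr _ using hr
    · exact ae_of_all _ fun r h => absurd h ha
  have h2 : ∀ᵐ r ∂uniformSeqLaw, ∀ a ∈ D, a < 1 → ∃ᶠ j in Filter.atTop, r j ∈ Set.Ioi a := by
    rw [ae_ball_iff hDc]
    intro a _
    by_cases ha : a < 1
    · filter_upwards [ae_frequently_mem volume (measurableSet_Ioi (a := a)) (by simpa using ha)]
        with r hr _ using hr
    · exact ae_of_all _ fun r h => absurd h ha
  -- A level `v` lies strictly between two levels of the countable dense set, or one such level and
  -- an endpoint, so one null set serves all `v`; it can then be used at the random level.
  filter_upwards [h1, h2] with r hr1 hr2 v hv0 hv1 c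
  rw [← Nat.frequently_atTop_iff_infinite]
  cases c
  · obtain ⟨a, haD, hva, ha1⟩ := hDd.exists_between hv1
    refine (hr2 a haD ha1).mono fun j hj => ?_
    simpa using hva.trans hj
  · obtain ⟨a, haD, ha0, hav⟩ := hDd.exists_between hv0
    refine (hr1 a haD ha0).mono fun j hj => ?_
    simpa using hj.trans hav.le

lemma ae_pos : ∀ᵐ x : I, 0 < x := by
  rw [ae_iff]
  have : {x : I | ¬0 < x} = {0} := by
    ext x
    simp
  rw [this]
  simp

/-- The law of the recursive separable permuton is a fixed point of `Φ_p`. -/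
lemma Phi_recLaw (p : I) : Phi p (recLaw p) = recLaw p := by
  set ν := ((Measure.infinitePi fun _ : Bool => drivingLaw p).prod (markLaw p)).prod
    uniformSeqLaw with hν
  have hae := aemeasurable_markPermuton p
  -- `markPermuton` is only almost everywhere measurable; a measurable version makes it possible to
  -- push product measures forward.
  obtain ⟨g, hg, hmg⟩ : ∃ g, Measurable g ∧ markPermuton =ᵐ[drivingLaw p] g :=
    ⟨_, hae.measurable_mk, hae.ae_eq_mk⟩
  have hgL : MeasurePreserving g (drivingLaw p) (recLaw p) :=
    ⟨hg, by rw [← map_markPermuton, Measure.map_congr hmg]⟩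
  have hpair : MeasurePreserving (fun θ : Bool → ℕ → I × Bool => (θ true, θ false))
      (Measure.infinitePi fun _ : Bool => drivingLaw p) ((drivingLaw p).prod (drivingLaw p)) :=
    ⟨by fun_prop, Measure.infinitePi_map_eval_prod (by simp)⟩
  have hfst : MeasurePreserving Prod.fst ν
      ((Measure.infinitePi fun _ : Bool => drivingLaw p).prod (markLaw p)) :=
    measurePreserving_fst
  have hK := (((hgL.prod hgL).comp hpair).prod (MeasurePreserving.id (markLaw p))).comp hfst
  have hglue := measurePreserving_glueSeq p
  have hθ : ∀ c : Bool, MeasurePreserving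
      (fun w : ((Bool → ℕ → I × Bool) × (I × Bool)) × (ℕ → I) => w.1.1 c) ν (drivingLaw p) :=
    fun c => (measurePreserving_eval_infinitePi (fun _ : Bool => drivingLaw p) c).comp
      (measurePreserving_fst.comp hfst)
  have hv : MeasurePreserving
      (fun w : ((Bool → ℕ → I × Bool) × (I × Bool)) × (ℕ → I) => w.1.2.1) ν volume :=
    (measurePreserving_fst (μ := (volume : Measure I)) (ν := signLaw p)).comp
      (measurePreserving_snd.comp hfst)
  have hr : MeasurePreserving
      (fun w : ((Bool → ℕ → I × Bool) × (I × Bool)) × (ℕ → I) => w.2) ν uniformSeqLaw :=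
    measurePreserving_snd
  -- The left side has law `recLaw p` since `glueSeq` preserves the driving law; the right side has
  -- law `Phi p (recLaw p)`, since its ingredients are independent.
  have key : (fun w => g (glueSeq w))
      =ᵐ[ν] fun w => glue w.1.2.1 w.1.2.2 (g (w.1.1 true)) (g (w.1.1 false)) := by
    filter_upwards [hglue.quasiMeasurePreserving.ae hmg,
      hglue.quasiMeasurePreserving.ae (ae_separating_mark p),
      (hθ true).quasiMeasurePreserving.ae hmg, (hθ false).quasiMeasurePreserving.ae hmg,
      (hθ true).quasiMeasurePreserving.ae (ae_separating_mark p),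
      (hθ false).quasiMeasurePreserving.ae (ae_separating_mark p),
      hv.quasiMeasurePreserving.ae ae_pos, hv.quasiMeasurePreserving.ae ae_lt_one,
      hr.quasiMeasurePreserving.ae ae_coins_infinite] with w e s e1 e0 s1 s0 hv0 hv1 hrw
    rw [← e, ← e1, ← e0]
    refine Subtype.ext (Subtype.ext ?_)
    change ((markPermuton (glueSeq w)).1 : Measure (I × I))
      = glueMeasure w.1.2.1 w.1.2.2 ((markPermuton (w.1.1 true)).1 : Measure (I × I))
        ((markPermuton (w.1.1 false)).1 : Measure (I × I))
    rw [markPermuton_coe s, markPermuton_coe s1, markPermuton_coe s0, glueSeq_fst, glueSeq_snd]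
    exact phiMeasure_glue hv0 hv1 (hrw _ hv0 hv1) w.1.2.2 (fun c j => (w.1.1 c j).1)
      (fun c j => (w.1.1 c j).2)
  have hL := (hgL.comp hglue).map_eq
  have h3 := Measure.map_map (μ := ν) measurable_glue hK.measurable
  rw [hK.map_eq] at h3
  refine Subtype.ext ?_
  change (Phi p (recLaw p) : Measure Permuton) = (recLaw p : Measure Permuton)
  rw [coe_Phi, h3, ← hL]
  exact (Measure.map_congr key).symm

/-- Reduces every almost-sure or distributional claim on `Ω` to the canonical product space. -/
lemma IsDrivingSequence.hasLaw_pair {Ω : Type*} [MeasurableSpace Ω] {P : Measure Ω}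
    [IsProbabilityMeasure P] {p : I} {U : ℕ → Ω → I} {S : ℕ → Ω → Bool}
    (h : IsDrivingSequence P p U S) :
    HasLaw (fun ω => ((fun j => U j ω, fun j => S j ω) : (ℕ → I) × (ℕ → Bool)))
      (uniformSeqLaw.prod (signSeqLaw p)) P := by
  have hU : AEMeasurable (fun ω j => U j ω) P :=
    aemeasurable_pi_lambda _ fun j => (h.hasLaw_U j).aemeasurable
  have hS : AEMeasurable (fun ω j => S j ω) P :=
    aemeasurable_pi_lambda _ fun j => (h.hasLaw_S j).aemeasurable
  refine ⟨hU.prodMk hS, ?_⟩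
  rw [(indepFun_iff_map_prod_eq_prod_map_map hU hS).1 h.indepFun,
    (h.iIndepFun_U.hasLaw_infinitePi h.hasLaw_U hU).map_eq,
    (h.iIndepFun_S.hasLaw_infinitePi h.hasLaw_S hS).map_eq]

end RecSep

theorem proposition1p3 (p : I) {Ω : Type*} [MeasurableSpace Ω] (P : Measure Ω)
    [IsProbabilityMeasure P] (U : ℕ → Ω → I) (S : ℕ → Ω → Bool)
    (hUS : RecSep.IsDrivingSequence P p U S) :
    (∀ᵐ ω ∂P, RecSep.IsPermuton (RecSep.phiMeasure (fun j => U j ω) (fun j => S j ω))) ∧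
    (∃ L : ProbabilityMeasure RecSep.Permuton,
      HasLaw (fun ω => RecSep.recPermuton (fun j => U j ω) (fun j => S j ω)) L P ∧
      RecSep.Phi p L = L ∧
      ∀ Q : ProbabilityMeasure RecSep.Permuton, RecSep.Phi p Q = Q → Q = L) ∧
    (∀ Q R : ProbabilityMeasure RecSep.Permuton,
      RecSep.lawDist (RecSep.Phi p Q) (RecSep.Phi p R) ≤ 2 / 3 * RecSep.lawDist Q R) := by
  have hlaw := hUS.hasLaw_pair
  have hfixed := RecSep.Phi_recLaw p
  refine ⟨?_, ⟨RecSep.recLaw p, ?_, hfixed, fun Q hQ => RecSep.Phi_fixed_unique p hQ hfixed⟩,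
    RecSep.lawDist_Phi_le p⟩
  · have hsep : ∀ᵐ q ∂(RecSep.uniformSeqLaw.prod (RecSep.signSeqLaw p)), RecSep.Separating q.1 :=
      Measure.quasiMeasurePreserving_fst.ae RecSep.ae_separating
    rw [← hlaw.map_eq] at hsep
    filter_upwards [ae_of_ae_map hlaw.aemeasurable hsep] with ω hω
    exact RecSep.isPermuton_phiMeasure hω _
  · have ha := RecSep.aemeasurable_recPair p
    rw [← hlaw.map_eq] at ha
    refine ⟨ha.comp_aemeasurable hlaw.aemeasurable, ?_⟩
    rw [RecSep.coe_recLaw, ← hlaw.map_eq]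
    exact (AEMeasurable.map_map_of_aemeasurable ha hlaw.aemeasurable).symm
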